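/- For $m,n\ge 0$ let $\mathbb{R}^{m,n}$ be $\mathbb{R}^{m+n}$ with the quadratic form $\mathfrak q_{m,n}(v)=-\sum_{i=1}^{m}v_i^2+\sum_{j=m+1}^{m+n}v_j^2$, let $O(m,n)$ be its group of linear isometries and $SO_\circ(m,n)$ the identity component of $O(m,n)$. Let $\mathbb{E}\mathrm{in}^{1,2}\subset\mathbb{RP}^4$ be the three-dimensional Einstein universe, i.e. the set of lines in $\mathbb{R}^{2,3}$ on which $\mathfrak q_{2,3}$ vanishes. Write $\mathbb{R}^{2,3}=\mathbb{R}^{1,0}\oplus\mathbb{R}^{1,3}$ and let $O(1,3)$ act on $\mathbb{E}\mathrm{in}^{1,2}$ by $A\cdot[t:x]=[t:Ax]$. This action preserves the decomposition $\mathbb{E}\mathrm{in}^{1,2}=\mathrm{dS}^{1,2}\cup\partial\mathrm{dS}^{1,2}$, where $\mathrm{dS}^{1,2}=\{x\in\mathbb{R}^{1,3}:\mathfrak q_{1,3}(x)=1\}$ is embedded by $x\mapsto[1:x]$ and $\partial\mathrm{dS}^{1,2}=\{[0:x]: x\neq 0,\ \mathfrak q_{1,3}(x)=0\}\cong\mathbb{S}^2$,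 and it identifies $\mathrm{Iso}_\circ(\mathrm{dS}^{1,2})$ with $SO_\circ(1,3)$. Let $G$ be a connected (not necessarily closed) Lie subgroup of $\mathrm{Iso}_\circ(\mathrm{dS}^{1,2})=SO_\circ(1,3)$ which acts on $\mathbb{E}\mathrm{in}^{1,2}$ with cohomogeneity one, i.e. some $G$-orbit in $\mathbb{E}\mathrm{in}^{1,2}$ has codimension one (dimension $2$). Then at least one of the following holds: (i) $G$ fixes a point of $\mathbb{E}\mathrm{in}^{1,2}$; (ii) $G$ is conjugate in $SO_\circ(1,3)$ to $SO(3)=\{\mathrm{diag}(1,R): R\in SO(3)\}$; (iii) $G=SO_\circ(1,3)$. -/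

import Mathlib

open scoped Matrix LinearAlgebra.Projectivization

noncomputable section

namespace EinsteinUniverse

/-- The quadratic form `-v₁² - ⋯ - vₘ² + vₘ₊₁² + ⋯ + vₘ₊ₙ²` of signature `(m, n)`
(`m` minus signs, `n` plus signs). -/
def q (m n : ℕ) : QuadraticForm ℝ (Fin (m + n) → ℝ) :=
  QuadraticMap.weightedSumSquares ℝ (fun i : Fin (m + n) => if (i : ℕ) < m then (-1 : ℝ) else 1)

/-- The group `O(m, n)` of linear isometries of `ℝ^{m,n}`. -/
def O (m n : ℕ) : Subgroup (GL (Fin (m + n)) ℝ) where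
  carrier := {g | ∀ v, q m n (g • v) = q m n v}
  one_mem' v := by rw [one_smul]
  mul_mem' {a b} ha hb v := by rw [mul_smul, ha, hb]
  inv_mem' {a} ha v := by rw [← ha, smul_inv_smul]

/-- `SO_∘(m, n)`, the identity component of `O(m, n)`. -/
def SO₀ (m n : ℕ) : Subgroup (GL (Fin (m + n)) ℝ) :=
  (Subgroup.connectedComponentOfOne (O m n)).map (O m n).subtype

/-- The block diagonal embedding `A ↦ diag(1, A)` of `k × k` matrices. -/
def blockMatrixHom (k : ℕ) :
    Matrix (Fin k) (Fin k) ℝ →* Matrix (Fin (1 + k)) (Fin (1 + k)) ℝ where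
  toFun A := Matrix.reindexAlgEquiv ℝ ℝ finSumFinEquiv (Matrix.fromBlocks 1 0 0 A)
  map_one' := by rw [Matrix.fromBlocks_one, map_one]
  map_mul' A B := by rw [← map_mul, Matrix.fromBlocks_multiply]; simp

/-- The block diagonal embedding `A ↦ diag(1, A)` of general linear groups. -/
def blockHom (k : ℕ) : GL (Fin k) ℝ →* GL (Fin (1 + k)) ℝ :=
  Units.map (blockMatrixHom k)

/-- The copy `{diag(1, A) : A ∈ SO(3)}` of `SO(3)` inside `GL(4, ℝ)`, which is the standard
maximal compact subgroup of `SO_∘(1, 3)`. -/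
def SO3 : Subgroup (GL (Fin 4) ℝ) :=
  (O 0 3 ⊓ (Matrix.GeneralLinearGroup.det (n := Fin 3) (R := ℝ)).ker).map (blockHom 3)

/-- The three-dimensional Einstein universe `Ein^{1,2}`: the set of lines of `ℝ^{2,3}`
on which the quadratic form vanishes. -/
def Ein : Set (ℙ ℝ (Fin 5 → ℝ)) :=
  {p | ∀ v ∈ p.submodule, q 2 3 v = 0}

/-- The action of `O(1, 3) = Iso(dS^{1,2})` on `Ein^{1,2} = dS^{1,2} ∪ ∂dS^{1,2}`, as a
homomorphism `A ↦ diag(1, A)` into linear automorphisms of `ℝ^{2,3} = ℝ^{1,0} ⊕ ℝ^{1,3}`.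
The de Sitter component consists of the points `[1 : x]` with `q 1 3 x = 1` (on which `A` acts by
`[1 : x] ↦ [1 : A x]`), and its boundary of the points `[0 : x]` with `x ≠ 0`, `q 1 3 x = 0`. -/
def deSitterHom : GL (Fin 4) ℝ →* GL (Fin 5) ℝ := blockHom 4

/-- The generators of the one-parameter subgroups contained in a subgroup `G` of `GL(k, ℝ)`;
if `G` is a Lie subgroup, this is its Lie algebra. -/
def lieAlg {k : ℕ} (G : Subgroup (GL (Fin k) ℝ)) : Set (Matrix (Fin k) (Fin k) ℝ) :=
  {X | ∀ t : ℝ, ∃ g ∈ G, (g : Matrix (Fin k) (Fin k) ℝ) = NormedSpace.exp (t • X)}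

/-- `G` is a connected (not necessarily closed) Lie subgroup of `GL(k, ℝ)`: the set `lieAlg G`
is a Lie subalgebra of `𝔤𝔩(k, ℝ)`, and every element of `G` is a finite product of exponentials
of elements of it. -/
def IsConnectedLieSubgroup {k : ℕ} (G : Subgroup (GL (Fin k) ℝ)) : Prop :=
  ∃ 𝔤 : Submodule ℝ (Matrix (Fin k) (Fin k) ℝ),
    (𝔤 : Set (Matrix (Fin k) (Fin k) ℝ)) = lieAlg G ∧
    (∀ X ∈ 𝔤, ∀ Y ∈ 𝔤, X * Y - Y * X ∈ 𝔤) ∧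
    G = Subgroup.closure
      {g : GL (Fin k) ℝ | ∃ X ∈ 𝔤, (g : Matrix (Fin k) (Fin k) ℝ) = NormedSpace.exp X}

/-- The velocity at `t = 0` of the curve `t ↦ exp (t X) p` in projective space, as an element of
the tangent space `T_p ℙ(V) = Hom(p, V / p)`. -/
def velocity {k : ℕ} (p : ℙ ℝ (Fin k → ℝ)) (X : Matrix (Fin k) (Fin k) ℝ) :
    p.submodule →ₗ[ℝ] (Fin k → ℝ) ⧸ p.submodule :=
  p.submodule.mkQ ∘ₗ X.mulVecLin ∘ₗ p.submodule.subtype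

/-- The tangent space `T_p (G p)` at `p` of the orbit of `p` under a Lie subgroup `G`. -/
def orbitTangentSpace {k : ℕ} (G : Subgroup (GL (Fin k) ℝ)) (p : ℙ ℝ (Fin k → ℝ)) :
    Submodule ℝ (p.submodule →ₗ[ℝ] (Fin k → ℝ) ⧸ p.submodule) :=
  Submodule.span ℝ (velocity p '' lieAlg G)

/-- The dimension of the orbit of `p` under a Lie subgroup `G`. -/
def orbitDim {k : ℕ} (G : Subgroup (GL (Fin k) ℝ)) (p : ℙ ℝ (Fin k → ℝ)) : ℕ :=
  Module.finrank ℝ (orbitTangentSpace G p)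

/-- A Lie subgroup `G` of `GL(5, ℝ)` (preserving the three-dimensional manifold `Ein^{1,2}`) acts
on `Ein^{1,2}` with cohomogeneity one: some orbit in `Ein^{1,2}` has codimension one, that is,
dimension two. -/
def ActsWithCohomogeneityOne (G : Subgroup (GL (Fin 5) ℝ)) : Prop :=
  ∃ p ∈ Ein, orbitDim G p = 2

end EinsteinUniverse

end

noncomputable section

namespace EinsteinUniverse

/-! As a real Lie algebra `𝔰𝔬(1, 3)` is `(ℂ³, ×)`, through `lorentz`, so `G` is generated by the
exponentials of a real subspace `𝔥` of `ℂ³` closed under the cross product. Such subspaces are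
sorted by their position relative to the complex structure and to the complex bilinear dot product.

If some nonzero `n` is orthogonal to `𝔥`, it can be replaced by a null vector `m`
(`exists_null_orthogonal`). The plane orthogonal to `m` is a Borel subalgebra, which preserves a
null line of `ℝ^{1,3}` (`exists_null_eigenvector`), so `G` fixes a point of the boundary sphere.

Otherwise `𝔥` spans `ℂ³` over `ℂ`. If `𝔥` contains a complex line, its largest complex subspace is a
nonzero ideal of the simple algebra `ℂ³`, so `𝔥` is everything (`eq_top_of_complex_line`) and `G` is
the whole identity component (`SO₀_le_of_forall_expGL_lorentz_mem`).

If `𝔥` is totally real, it is a real form of `ℂ³`. The dot product is then real on `𝔥`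
(`im_dotProduct_eq_zero`), and this forces a common kernel vector `x` in `ℝ^{1,3}`
(`exists_lorentz_kernel_vector`). If `x` is spacelike or null, `[√q(x) : x]` is a fixed point in the
Einstein universe. If `x` is timelike, `𝔥` is its full infinitesimal stabilizer, and moving `x` to
the time axis conjugates `G` to `SO(3)`. -/

/-! ### Subalgebras of the complex cross product algebra: degenerate and complex cases. -/

theorem cross_cross_eq {R : Type*} [CommRing R] (u v w : Fin 3 → R) :
    u ⨯₃ (v ⨯₃ w) = (u ⬝ᵥ w) • v - (u ⬝ᵥ v) • w := by
  rw [cross_cross_eq_smul_sub_smul', dotProduct_comm v u]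

/-- If `n` is not null, a bracket of two elements of `𝔤` is parallel to `n` as a cross product and
orthogonal to `n` as an element of `𝔤`, hence zero. So `𝔤` is abelian, and the null vector can be
built from `n` and one nonzero element `c`. -/
theorem exists_null_orthogonal {𝔤 : Submodule ℝ (Fin 3 → ℂ)}
    (hbr : ∀ c ∈ 𝔤, ∀ d ∈ 𝔤, c ⨯₃ d ∈ 𝔤) {n : Fin 3 → ℂ} (hn : n ≠ 0)
    (h : ∀ c ∈ 𝔤, n ⬝ᵥ c = 0) :
    ∃ m : Fin 3 → ℂ, m ≠ 0 ∧ m ⬝ᵥ m = 0 ∧ ∀ c ∈ 𝔤, m ⬝ᵥ c = 0 := by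
  by_cases hnn : n ⬝ᵥ n = 0
  · exact ⟨n, hn, hnn, h⟩
  by_cases h0 : ∀ c ∈ 𝔤, c = 0
  · refine ⟨![1, Complex.I, 0], fun e => ?_, ?_, fun c hc => ?_⟩
    · simpa using congrFun e 0
    · simp [dotProduct, Fin.sum_univ_three]
    · rw [h0 c hc, dotProduct_zero]
  push Not at h0
  obtain ⟨c, hc, hc0⟩ := h0
  have hpar : ∀ d ∈ 𝔤, c ⨯₃ d = 0 := by
    intro d hd
    have h1 := cross_cross_eq n n (c ⨯₃ d)
    rw [cross_cross_eq n c d, h c hc, h d hd, h _ (hbr c hc d hd)] at h1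
    simpa [hnn] using h1
  obtain ⟨z, hz⟩ := IsAlgClosed.exists_pow_nat_eq (-(c ⬝ᵥ c)) (n := 2) (by norm_num)
  -- Since `n` and `n × c` are orthogonal and `(n × c)² = (n · n)(c · c)`, the choice `z² = -(c ·
  -- c)` makes this vector null.
  refine ⟨z • n + n ⨯₃ c, fun e => ?_, ?_, fun d hd => ?_⟩
  · have h1 : n ⬝ᵥ (z • n + n ⨯₃ c) = 0 := by rw [e, dotProduct_zero]
    rw [dotProduct_add, dot_self_cross, dotProduct_smul, smul_eq_mul, add_zero] at h1
    have hz0 : z = 0 := (mul_eq_zero.mp h1).resolve_right hnn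
    rw [hz0, zero_smul, zero_add] at e
    have h2 := cross_cross_eq n n c
    rw [e, h c hc] at h2
    exact hc0 (by simpa [hnn] using h2)
  · have h1 : (n ⨯₃ c) ⬝ᵥ (n ⨯₃ c) = (n ⬝ᵥ n) * (c ⬝ᵥ c) := by
      rw [cross_dot_cross, h c hc]; ring
    have h2 : (n ⨯₃ c) ⬝ᵥ n = 0 := by rw [dotProduct_comm, dot_self_cross]
    simp only [add_dotProduct, dotProduct_add, smul_dotProduct, dotProduct_smul, smul_eq_mul, h1,
      h2, dot_self_cross]
    linear_combination (n ⬝ᵥ n) * hz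
  · rw [add_dotProduct, smul_dotProduct, h d hd, dotProduct_comm, triple_product_permutation,
      hpar d hd]
    simp

theorem span_eq_top_of_forall_dotProduct {s : Set (Fin 3 → ℂ)}
    (h : ∀ n : Fin 3 → ℂ, (∀ c ∈ s, n ⬝ᵥ c = 0) → n = 0) : Submodule.span ℂ s = ⊤ := by
  by_contra hs
  obtain ⟨f, hf, hle⟩ := Submodule.exists_le_ker_of_lt_top _ (lt_top_iff_ne_top.mpr hs)
  obtain ⟨n, rfl⟩ := (dotProductEquiv ℂ (Fin 3)).surjective f
  refine hf ?_
  rw [h n fun c hc => by simpa using hle (Submodule.subset_span hc), map_zero]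

/-- The largest complex subspace `W` of `𝔤` absorbs brackets with `𝔤`, hence with its complex span,
so it is an ideal of `ℂ³`. A nonzero ideal is everything: bracketing `w` with `y` and then with a
basis vector recovers `y` modulo `w`, up to a coordinate of `w`. -/
theorem eq_top_of_complex_line {𝔤 : Submodule ℝ (Fin 3 → ℂ)}
    (hbr : ∀ c ∈ 𝔤, ∀ d ∈ 𝔤, c ⨯₃ d ∈ 𝔤)
    (hspan : Submodule.span ℂ (𝔤 : Set (Fin 3 → ℂ)) = ⊤) {w : Fin 3 → ℂ} (hw : w ≠ 0)
    (h1 : w ∈ 𝔤) (h2 : Complex.I • w ∈ 𝔤) : 𝔤 = ⊤ := by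
  have hmem : ∀ {x : Fin 3 → ℂ}, x ∈ 𝔤 → Complex.I • x ∈ 𝔤 → ∀ z : ℂ, z • x ∈ 𝔤 := by
    intro x hx hx' z
    have : z • x = z.re • x + z.im • Complex.I • x := by
      ext i
      simp only [Pi.smul_apply, Pi.add_apply, smul_eq_mul, Complex.real_smul]
      conv_lhs => rw [← Complex.re_add_im z]
      ring
    rw [this]
    exact 𝔤.add_mem (𝔤.smul_mem _ hx) (𝔤.smul_mem _ hx')
  let W : Submodule ℂ (Fin 3 → ℂ) :=
    { carrier := {x | ∀ z : ℂ, z • x ∈ 𝔤}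
      add_mem' := fun {a b} ha hb z => by rw [smul_add]; exact 𝔤.add_mem (ha z) (hb z)
      zero_mem' := fun z => by rw [smul_zero]; exact 𝔤.zero_mem
      smul_mem' := fun y x hx z => by rw [smul_smul]; exact hx _ }
  have hW : w ∈ W := hmem h1 h2
  have hid : ∀ x ∈ W, ∀ y, x ⨯₃ y ∈ W := by
    intro x hx y
    have hy : y ∈ Submodule.span ℂ (𝔤 : Set (Fin 3 → ℂ)) := by rw [hspan]; trivial
    induction hy using Submodule.span_induction with
    | mem y hy =>
      intro z
      rw [← LinearMap.smul_apply, ← map_smul]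
      exact hbr _ (hx z) _ hy
    | zero => rw [map_zero]; exact W.zero_mem
    | add a b _ _ ha hb => rw [map_add]; exact W.add_mem ha hb
    | smul a b _ hb => rw [map_smul]; exact W.smul_mem a hb
  obtain ⟨i, hi⟩ := Function.ne_iff.mp hw
  refine Submodule.eq_top_iff'.mpr fun y => ?_
  have h3 := cross_cross_eq (Pi.single i 1) y w
  have h4 : (Pi.single i 1 : Fin 3 → ℂ) ⨯₃ (y ⨯₃ w) ∈ W := by
    rw [← cross_anticomm, neg_mem_iff, ← cross_anticomm w y, LinearMap.map_neg,
      LinearMap.neg_apply, neg_mem_iff]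
    exact hid _ (hid _ hW y) _
  have h5 : (w i) • y ∈ W := by
    have := W.add_mem h4 (W.smul_mem ((Pi.single i 1 : Fin 3 → ℂ) ⬝ᵥ y) hW)
    rw [h3] at this
    simpa using this
  have h6 := h5 (w i)⁻¹
  rwa [smul_smul, inv_mul_cancel₀ hi, one_smul] at h6

/-! ### The isomorphism with the Lorentz algebra and common kernels. -/

/-- The real part of a complex vector. -/
def reVec : (Fin 3 → ℂ) →ₗ[ℝ] (Fin 3 → ℝ) := Complex.reLm.compLeft (Fin 3)

/-- The imaginary part of a complex vector. -/
def imVec : (Fin 3 → ℂ) →ₗ[ℝ] (Fin 3 → ℝ) := Complex.imLm.compLeft (Fin 3)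

theorem reVec_apply (c : Fin 3 → ℂ) (i : Fin 3) : reVec c i = (c i).re := rfl

theorem imVec_apply (c : Fin 3 → ℂ) (i : Fin 3) : imVec c i = (c i).im := rfl

/-- The isomorphism of `(ℂ³, ×)` with `𝔰𝔬(1, 3)`; the real part of `c` is the infinitesimal
rotation and the imaginary part the infinitesimal boost. -/
def lorentz : (Fin 3 → ℂ) →ₗ[ℝ] Matrix (Fin 4) (Fin 4) ℝ where
  toFun c := !![0, (c 0).im, (c 1).im, (c 2).im;
    (c 0).im, 0, -(c 2).re, (c 1).re;
    (c 1).im, (c 2).re, 0, -(c 0).re;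
    (c 2).im, -(c 1).re, (c 0).re, 0]
  map_add' c d := by
    ext i j
    fin_cases i <;> fin_cases j <;> simp <;> ring
  map_smul' r c := by
    ext i j
    fin_cases i <;> fin_cases j <;> simp

theorem lorentz_mulVec (c : Fin 3 → ℂ) (t : ℝ) (v : Fin 3 → ℝ) :
    lorentz c *ᵥ Matrix.vecCons t v =
      Matrix.vecCons (imVec c ⬝ᵥ v) (t • imVec c + reVec c ⨯₃ v) := by
  ext i
  fin_cases i <;> simp [lorentz, Matrix.mulVec, dotProduct, Fin.sum_univ_succ, cross_apply,
    reVec_apply, imVec_apply, Matrix.vecHead, Matrix.vecTail] <;> ring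

theorem lorentz_bracket (c d : Fin 3 → ℂ) :
    lorentz c * lorentz d - lorentz d * lorentz c = lorentz (c ⨯₃ d) := by
  ext i j
  fin_cases i <;> fin_cases j <;>
    simp [lorentz, cross_apply] <;> ring

/-- Here `(a, b)` and `(c, d)` are the boost and rotation parts of two elements. The first one kills
`(0, b)` and `(b · b, b × a)`; their images under the second have spatial parts `u₂ = d × b` and
`u₁`. The hypotheses make `u₁` orthogonal to both `b` and `d`, hence parallel to `u₂`, so some
combination is killed by both elements. -/
theorem exists_common_kernel_vector {a b c d : Fin 3 → ℝ} (hb : b ≠ 0) (hab : a ⬝ᵥ b = 0)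
    (hcd : c ⬝ᵥ d = 0) (h : b ⬝ᵥ c + a ⬝ᵥ d = 0) :
    ∃ (t : ℝ) (v : Fin 3 → ℝ), Matrix.vecCons t v ≠ 0 ∧ t • a + b ⨯₃ v = 0 ∧ t • c + d ⨯₃ v = 0 ∧
      a ⬝ᵥ v = 0 ∧ c ⬝ᵥ v = 0 := by
  have hbb : b ⬝ᵥ b ≠ 0 := by rwa [Ne, dotProduct_self_eq_zero]
  by_cases hu : d ⨯₃ b = 0
  · refine ⟨0, b, fun e => hb ?_, by simp, by simp [hu], hab, ?_⟩
    · ext i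
      simpa using congrFun e i.succ
    · have h1 : a ⬝ᵥ (b ⨯₃ (d ⨯₃ b)) = 0 := by simp [hu]
      rw [cross_cross_eq, dotProduct_sub, dotProduct_smul, dotProduct_smul, hab] at h1
      have h2 : a ⬝ᵥ d = 0 := by simpa [hbb] using h1
      rw [dotProduct_comm]
      linarith
  have huu : (d ⨯₃ b) ⬝ᵥ (d ⨯₃ b) ≠ 0 := by rwa [Ne, dotProduct_self_eq_zero]
  set u₂ := d ⨯₃ b with hu₂
  set u₁ := (b ⬝ᵥ b) • c + d ⨯₃ (b ⨯₃ a) with hu₁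
  have h1 : u₁ ⨯₃ u₂ = 0 := by
    have e1 : u₁ ⬝ᵥ b = 0 := by
      simp only [hu₁, cross_cross_eq, add_dotProduct, sub_dotProduct, smul_dotProduct, smul_eq_mul,
        hab]
      rw [dotProduct_comm c b, dotProduct_comm d a]
      linear_combination (b ⬝ᵥ b) * h
    have e2 : u₁ ⬝ᵥ d = 0 := by
      simp only [hu₁, cross_cross_eq, add_dotProduct, sub_dotProduct, smul_dotProduct, smul_eq_mul,
        hcd]
      rw [dotProduct_comm d a, dotProduct_comm d b]
      ring
    rw [hu₂, cross_cross_eq, e1, e2, zero_smul, zero_smul, sub_zero]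
  have h2 : (u₂ ⬝ᵥ u₂) • u₁ - (u₂ ⬝ᵥ u₁) • u₂ = 0 := by
    rw [← cross_cross_eq, h1, map_zero]
  have h3 : ((u₂ ⬝ᵥ u₂) * (b ⬝ᵥ b)) • c + d ⨯₃ ((u₂ ⬝ᵥ u₂) • (b ⨯₃ a) - (u₂ ⬝ᵥ u₁) • b) = 0 := by
    rw [← h2, map_sub, LinearMap.map_smul, LinearMap.map_smul, ← hu₂]
    simp only [hu₁, smul_add, smul_smul]
    abel
  have ht : (u₂ ⬝ᵥ u₂) * (b ⬝ᵥ b) ≠ 0 := mul_ne_zero huu hbb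
  refine ⟨(u₂ ⬝ᵥ u₂) * (b ⬝ᵥ b), (u₂ ⬝ᵥ u₂) • (b ⨯₃ a) - (u₂ ⬝ᵥ u₁) • b, fun e => ht ?_, ?_, h3, ?_,
    ?_⟩
  · simpa using congrFun e 0
  · rw [map_sub, LinearMap.map_smul, LinearMap.map_smul, cross_self, cross_cross_eq,
      dotProduct_comm b a, hab]
    module
  · rw [dotProduct_sub, dotProduct_smul, dotProduct_smul, hab, dot_cross_self]
    simp
  -- Pairing `t c + d × v = 0` with `v` leaves `t (c · v) = 0`, and `t ≠ 0`.
  · have h4 := congrArg (· ⬝ᵥ ((u₂ ⬝ᵥ u₂) • (b ⨯₃ a) - (u₂ ⬝ᵥ u₁) • b)) h3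
    simp only [add_dotProduct, smul_dotProduct, zero_dotProduct] at h4
    rw [dotProduct_comm (d ⨯₃ (_ - _)), dot_cross_self, add_zero, smul_eq_mul] at h4
    exact (mul_eq_zero.mp h4).resolve_left ht

/-! ### Totally real subalgebras. -/

/-- By polarization some `e` is not null. If every `(e × d)² = (e · e)(d · d) - (e · d)²` vanished,
polarizing in `d` would make `𝔤` parallel to `e`; then every `e × y` is orthogonal to `𝔤`, which
forces `e = 0`. -/
theorem exists_nondegenerate_pair {𝔤 : Submodule ℝ (Fin 3 → ℂ)}
    (hnd : ∀ n : Fin 3 → ℂ, (∀ c ∈ 𝔤, n ⬝ᵥ c = 0) → n = 0) :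
    ∃ c ∈ 𝔤, ∃ d ∈ 𝔤, (c ⨯₃ d) ⬝ᵥ (c ⨯₃ d) ≠ 0 := by
  have hne : ¬ ∀ n : Fin 3 → ℂ, n = 0 := fun h => by simpa using congrFun (h 1) 0
  have h1 : ∃ e ∈ 𝔤, e ⬝ᵥ e ≠ 0 := by
    by_contra! h0
    refine hne fun n => hnd n fun c hc => ?_
    rw [hnd c fun d hd => ?_, dotProduct_zero]
    have h1 := h0 _ (𝔤.add_mem hc hd)
    simp only [add_dotProduct, dotProduct_add, h0 c hc, h0 d hd, dotProduct_comm d c] at h1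
    linear_combination h1 / 2
  obtain ⟨e, he, hee⟩ := h1
  refine ⟨e, he, ?_⟩
  by_contra! h0
  have h2 : ∀ d ∈ 𝔤, (e ⬝ᵥ e) • d - (e ⬝ᵥ d) • e = 0 := by
    intro d hd
    refine hnd _ fun f hf => ?_
    have h1 := h0 _ (𝔤.add_mem hd hf)
    have h3 := h0 _ hd
    have h4 := h0 _ hf
    rw [cross_dot_cross] at h1 h3 h4
    simp only [add_dotProduct, dotProduct_add, dotProduct_comm f d, dotProduct_comm f e,
      dotProduct_comm d e] at h1 h3 h4
    simp only [sub_dotProduct, smul_dotProduct, smul_eq_mul]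
    linear_combination (h1 - h3 - h4) / 2
  have h5 : ∀ y, e ⨯₃ y = 0 := by
    refine fun y => hnd _ fun c hc => ?_
    have h6 := congrArg (fun x => (e ⨯₃ y) ⬝ᵥ x) (h2 c hc)
    simp only [dotProduct_sub, dotProduct_smul, dotProduct_comm (e ⨯₃ y) e, dot_self_cross] at h6
    simpa [hee] using h6
  have hx := h5 ![1, 0, 0]
  have hy := h5 ![0, 1, 0]
  have e0 : e = 0 := by
    ext i
    fin_cases i
    · simpa [cross_apply] using congrFun hy 2
    · simpa [cross_apply] using congrFun hx 2
    · simpa [cross_apply] using congrFun hx 1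
  exact hee (by simp [e0])

/-- The double bracket `c × (c × d) = (c · d) c - (c · c) d` lies in `𝔤`. Removing its
real-coefficient part leaves `I` times an element of `𝔤`, which must vanish. If `c · c` were not
real, `𝔤` would be the real line through `c`, contradicting `exists_nondegenerate_pair`. -/
theorem im_dotProduct_eq_zero {𝔤 : Submodule ℝ (Fin 3 → ℂ)}
    (hbr : ∀ c ∈ 𝔤, ∀ d ∈ 𝔤, c ⨯₃ d ∈ 𝔤)
    (hnd : ∀ n : Fin 3 → ℂ, (∀ c ∈ 𝔤, n ⬝ᵥ c = 0) → n = 0)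
    (hreal : ∀ c ∈ 𝔤, Complex.I • c ∈ 𝔤 → c = 0) {c d : Fin 3 → ℂ} (hc : c ∈ 𝔤) (hd : d ∈ 𝔤) :
    (c ⬝ᵥ d).im = 0 := by
  have key : ∀ c ∈ 𝔤, ∀ d ∈ 𝔤, (c ⬝ᵥ d).im • c - (c ⬝ᵥ c).im • d = 0 := by
    intro c hc d hd
    refine hreal _ (𝔤.sub_mem (𝔤.smul_mem _ hc) (𝔤.smul_mem _ hd)) ?_
    have h1 : Complex.I • ((c ⬝ᵥ d).im • c - (c ⬝ᵥ c).im • d) =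
        c ⨯₃ (c ⨯₃ d) - ((c ⬝ᵥ d).re • c - (c ⬝ᵥ c).re • d) := by
      rw [cross_cross_eq]
      ext i
      simp only [Pi.smul_apply, Pi.sub_apply, smul_eq_mul, Complex.real_smul]
      linear_combination c i * Complex.re_add_im (c ⬝ᵥ d) - d i * Complex.re_add_im (c ⬝ᵥ c)
    rw [h1]
    exact 𝔤.sub_mem (hbr c hc _ (hbr c hc d hd))
      (𝔤.sub_mem (𝔤.smul_mem _ hc) (𝔤.smul_mem _ hd))
  have hsq : ∀ c ∈ 𝔤, (c ⬝ᵥ c).im = 0 := by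
    intro c hc
    by_contra h0
    obtain ⟨e, he, f, hf, hef⟩ := exists_nondegenerate_pair hnd
    have hpar : ∀ d ∈ 𝔤, ∃ r : ℝ, d = r • c := fun d hd =>
      ⟨(c ⬝ᵥ c).im⁻¹ * (c ⬝ᵥ d).im, by
        rw [mul_smul, sub_eq_zero.mp (key c hc d hd), inv_smul_smul₀ h0]⟩
    obtain ⟨r, rfl⟩ := hpar e he
    obtain ⟨s, rfl⟩ := hpar f hf
    refine hef ?_
    have h1 : (r • c) ⨯₃ (s • c) = 0 := by
      have : ∀ x : ℝ, x • c = (x : ℂ) • c := fun x => by ext i; simp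
      rw [this, this, LinearMap.map_smul, LinearMap.map_smul, LinearMap.smul_apply, cross_self,
        smul_zero, smul_zero]
    rw [h1, dotProduct_zero]
  have h1 := hsq _ (𝔤.add_mem hc hd)
  simp only [add_dotProduct, dotProduct_add, dotProduct_comm d c, Complex.add_im, hsq c hc,
    hsq d hd] at h1
  linarith

theorem dotProduct_im (c d : Fin 3 → ℂ) :
    (c ⬝ᵥ d).im = reVec c ⬝ᵥ imVec d + imVec c ⬝ᵥ reVec d := by
  simp [dotProduct, Fin.sum_univ_three, reVec_apply, imVec_apply]
  ring

theorem exists_lorentz_kernel_vector_of_im_eq_zero {c d : Fin 3 → ℂ} (hcc : (c ⬝ᵥ c).im = 0)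
    (hcd : (c ⬝ᵥ d).im = 0) (hdd : (d ⬝ᵥ d).im = 0) (hne : c ⨯₃ d ≠ 0) :
    ∃ x : Fin 4 → ℝ, x ≠ 0 ∧ lorentz c *ᵥ x = 0 ∧ lorentz d *ᵥ x = 0 := by
  rw [dotProduct_im] at hcc hcd hdd
  rw [dotProduct_comm (reVec c)] at hcc
  rw [dotProduct_comm (imVec d)] at hdd
  have hcc' : imVec c ⬝ᵥ reVec c = 0 := by linarith
  have hdd' : imVec d ⬝ᵥ reVec d = 0 := by
    rw [dotProduct_comm]
    linarith
  by_cases hb : reVec c = 0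
  · by_cases hb' : reVec d = 0
    -- Both elements are pure boosts, so they kill any spatial vector orthogonal to both directions.
    · refine ⟨Matrix.vecCons 0 (imVec c ⨯₃ imVec d), fun e => hne ?_, ?_, ?_⟩
      · have h0 : imVec c ⨯₃ imVec d = 0 := by
          ext i
          simpa using congrFun e i.succ
        have hI : ∀ c, reVec c = 0 → ∀ i, c i = Complex.I * (imVec c i : ℂ) := by
          intro c hc i
          conv_lhs => rw [← Complex.re_add_im (c i), ← reVec_apply, hc]
          simp [imVec_apply, mul_comm]
        have h1 : c ⨯₃ d = fun i => -(((imVec c ⨯₃ imVec d) i : ℝ) : ℂ) := by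
          ext i
          fin_cases i <;> simp [cross_apply, hI c hb, hI d hb'] <;> ring_nf <;> simp
        rw [h1, h0]
        ext i
        simp
      · rw [lorentz_mulVec, hb]
        ext i
        refine Fin.cases ?_ (fun j => ?_) i <;> simp
      · rw [lorentz_mulVec, hb']
        ext i
        refine Fin.cases ?_ (fun j => ?_) i <;> simp
    · obtain ⟨t, v, h0, h1, h2, h3, h4⟩ := exists_common_kernel_vector (a := imVec d) (b := reVec d)
        (c := imVec c) (d := reVec c) hb' hdd' hcc' (by
          rw [dotProduct_comm (reVec d), dotProduct_comm (imVec d)]; linarith)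
      refine ⟨_, h0, ?_, ?_⟩ <;> rw [lorentz_mulVec] <;> simp [h1, h2, h3, h4]
  · obtain ⟨t, v, h0, h1, h2, h3, h4⟩ := exists_common_kernel_vector (a := imVec c) (b := reVec c)
      (c := imVec d) (d := reVec d) hb hcc' hdd' hcd
    refine ⟨_, h0, ?_, ?_⟩ <;> rw [lorentz_mulVec] <;> simp [h1, h2, h3, h4]

theorem exists_lorentz_kernel_vector {𝔤 : Submodule ℝ (Fin 3 → ℂ)}
    (hbr : ∀ c ∈ 𝔤, ∀ d ∈ 𝔤, c ⨯₃ d ∈ 𝔤)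
    (hnd : ∀ n : Fin 3 → ℂ, (∀ c ∈ 𝔤, n ⬝ᵥ c = 0) → n = 0)
    (hreal : ∀ c ∈ 𝔤, Complex.I • c ∈ 𝔤 → c = 0) :
    ∃ x : Fin 4 → ℝ, x ≠ 0 ∧ ∀ c ∈ 𝔤, lorentz c *ᵥ x = 0 := by
  obtain ⟨c, hc, d, hd, hcd⟩ := exists_nondegenerate_pair hnd
  have him : ∀ {c d}, c ∈ 𝔤 → d ∈ 𝔤 → (c ⬝ᵥ d).im = 0 := im_dotProduct_eq_zero hbr hnd hreal
  obtain ⟨x, hx, hcx, hdx⟩ := exists_lorentz_kernel_vector_of_im_eq_zero (him hc hc) (him hc hd)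
    (him hd hd) (fun h => hcd (by rw [h, dotProduct_zero]))
  refine ⟨x, hx, fun y hy => ?_⟩
  set n := c ⨯₃ d with hn
  have hnmem : n ∈ 𝔤 := hbr c hc d hd
  have hnx : lorentz n *ᵥ x = 0 := by
    rw [hn, ← lorentz_bracket, Matrix.sub_mulVec, ← Matrix.mulVec_mulVec, ← Matrix.mulVec_mulVec,
      hcx, hdx, Matrix.mulVec_zero, Matrix.mulVec_zero, sub_zero]
  -- Expansion of `y` in the basis `c, d, n`, whose determinant is `n · n`, by the reciprocal basis.
  -- All coefficients are dot products of elements of `𝔤`, hence real, so the real-linear `lorentz`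
  -- passes through.
  have hexp : (n ⬝ᵥ n) • y = (y ⬝ᵥ (d ⨯₃ n)) • c + (y ⬝ᵥ (n ⨯₃ c)) • d + (y ⬝ᵥ n) • n := by
    ext i
    fin_cases i <;>
      simp [hn, cross_apply, dotProduct, Fin.sum_univ_three] <;> ring
  have hre : ∀ {c d}, c ∈ 𝔤 → d ∈ 𝔤 → ∀ e : Fin 3 → ℂ, (c ⬝ᵥ d) • e = (c ⬝ᵥ d).re • e := by
    intro c d hc hd e
    ext i
    simp only [Pi.smul_apply, smul_eq_mul, Complex.real_smul]
    conv_lhs => rw [← Complex.re_add_im (c ⬝ᵥ d), him hc hd]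
    simp
  rw [hre hnmem hnmem, hre hy (hbr d hd n hnmem), hre hy (hbr n hnmem c hc), hre hy hnmem] at hexp
  have h0 : (n ⬝ᵥ n).re ≠ 0 := fun h => hcd (Complex.ext h (him hnmem hnmem))
  have h1 := congrArg (fun z => lorentz z *ᵥ x) hexp
  simp only [map_add, map_smul, Matrix.add_mulVec, Matrix.smul_mulVec, hcx, hdx, hnx,
    smul_zero, add_zero] at h1
  exact (smul_eq_zero.mp h1).resolve_left h0

theorem exists_eq_add_I_smul {𝔤 : Submodule ℝ (Fin 3 → ℂ)}
    (hspan : Submodule.span ℂ (𝔤 : Set (Fin 3 → ℂ)) = ⊤) (y : Fin 3 → ℂ) :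
    ∃ c ∈ 𝔤, ∃ d ∈ 𝔤, y = c + Complex.I • d := by
  have hy : y ∈ Submodule.span ℂ (𝔤 : Set (Fin 3 → ℂ)) := by rw [hspan]; trivial
  induction hy using Submodule.span_induction with
  | mem y hy => exact ⟨y, hy, 0, 𝔤.zero_mem, by simp⟩
  | zero => exact ⟨0, 𝔤.zero_mem, 0, 𝔤.zero_mem, by simp⟩
  | add a b _ _ ha hb =>
    obtain ⟨c, hc, d, hd, rfl⟩ := ha
    obtain ⟨e, he, f, hf, rfl⟩ := hb
    exact ⟨c + e, 𝔤.add_mem hc he, d + f, 𝔤.add_mem hd hf, by module⟩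
  | smul z b _ hb =>
    obtain ⟨c, hc, d, hd, rfl⟩ := hb
    refine ⟨z.re • c - z.im • d, 𝔤.sub_mem (𝔤.smul_mem _ hc) (𝔤.smul_mem _ hd),
      z.im • c + z.re • d, 𝔤.add_mem (𝔤.smul_mem _ hc) (𝔤.smul_mem _ hd), ?_⟩
    ext i
    simp only [Pi.smul_apply, Pi.add_apply, Pi.sub_apply, smul_eq_mul, Complex.real_smul]
    conv_lhs => rw [← Complex.re_add_im z]
    linear_combination (z.im : ℂ) * d i * Complex.I_mul_I

/-! ### The Lorentz form and its isometries. -/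

/-- The Gram matrix of the Lorentzian form on `ℝ^{1,3}`. -/
def gram : Matrix (Fin 4) (Fin 4) ℝ := Matrix.diagonal ![-1, 1, 1, 1]

/-- The Lorentzian inner product on `ℝ^{1,3}`. -/
def mink (x y : Fin 4 → ℝ) : ℝ := x ⬝ᵥ (gram *ᵥ y)

theorem mink_apply (x y : Fin 4 → ℝ) :
    mink x y = -(x 0 * y 0) + x 1 * y 1 + x 2 * y 2 + x 3 * y 3 := by
  simp [mink, gram, dotProduct, Fin.sum_univ_succ, Matrix.mulVec_diagonal]
  ring

theorem q_eq_mink (v : Fin 4 → ℝ) : q 1 3 v = mink v v := by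
  simp [q, QuadraticMap.weightedSumSquares_apply, Fin.sum_univ_succ, mink_apply]
  ring

theorem gram_mul_gram : gram * gram = 1 := by
  rw [gram, Matrix.diagonal_mul_diagonal, ← Matrix.diagonal_one]
  congr 1
  ext i
  fin_cases i <;> simp

theorem mink_mulVec (A : Matrix (Fin 4) (Fin 4) ℝ) (x y : Fin 4 → ℝ) :
    mink (A *ᵥ x) (A *ᵥ y) = x ⬝ᵥ ((Aᵀ * gram * A) *ᵥ y) := by
  rw [mink, ← Matrix.vecMul_transpose, ← Matrix.dotProduct_mulVec, Matrix.mulVec_mulVec,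
    Matrix.mulVec_mulVec, Matrix.mul_assoc]

theorem transpose_mul_gram_mul_iff (A : Matrix (Fin 4) (Fin 4) ℝ) :
    Aᵀ * gram * A = gram ↔ ∀ x y, mink (A *ᵥ x) (A *ᵥ y) = mink x y := by
  refine ⟨fun h x y => by rw [mink_mulVec, h, mink], fun h => ?_⟩
  ext i j
  have := h (Pi.single i 1) (Pi.single j 1)
  rw [mink_mulVec, mink] at this
  simpa using this

theorem mem_O_iff {g : GL (Fin 4) ℝ} :
    g ∈ O 1 3 ↔ (g : Matrix (Fin 4) (Fin 4) ℝ)ᵀ * gram * g = gram := by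
  rw [transpose_mul_gram_mul_iff]
  constructor
  · intro h x y
    have h' : ∀ v, mink ((g : Matrix (Fin 4) (Fin 4) ℝ) *ᵥ v)
        ((g : Matrix (Fin 4) (Fin 4) ℝ) *ᵥ v) = mink v v := fun v => by
      rw [← q_eq_mink, ← q_eq_mink]
      exact h v
    have h1 := h' (x + y)
    have hx := h' x
    have hy := h' y
    simp only [Matrix.mulVec_add, mink_apply, Pi.add_apply] at h1 hx hy ⊢
    linear_combination (h1 - hx - hy) / 2
  · intro h v
    change q 1 3 ((g : Matrix (Fin 4) (Fin 4) ℝ) *ᵥ v) = _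
    rw [q_eq_mink, q_eq_mink, h]

theorem mem_range_lorentz_iff (X : Matrix (Fin 4) (Fin 4) ℝ) :
    (∃ c, lorentz c = X) ↔ Xᵀ * gram + gram * X = 0 := by
  have hent : ∀ i j, (Xᵀ * gram + gram * X) i j =
      X j i * ![-1, 1, 1, 1] j + ![-1, 1, 1, 1] i * X i j := fun i j => by
    simp [gram, Matrix.mul_diagonal, Matrix.diagonal_mul]
  constructor
  · rintro ⟨c, rfl⟩
    ext i j
    rw [hent]
    fin_cases i <;> fin_cases j <;> simp [lorentz]
  · intro h
    have h' : ∀ i j, X j i * ![-1, 1, 1, 1] j + ![-1, 1, 1, 1] i * X i j = 0 := fun i j => by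
      rw [← hent, h, Matrix.zero_apply]
    refine ⟨![⟨X 3 2, X 0 1⟩, ⟨X 1 3, X 0 2⟩, ⟨X 2 1, X 0 3⟩], ?_⟩
    ext i j
    have h1 := h' i j
    fin_cases i <;> fin_cases j <;> simp [lorentz] at h1 ⊢ <;> linarith

/-! ### Matrix exponentials. -/

theorem hasDerivAt_exp_smul_apply {k : ℕ} (X : Matrix (Fin k) (Fin k) ℝ) (i j : Fin k) (t : ℝ) :
    HasDerivAt (fun t : ℝ => NormedSpace.exp (t • X) i j) ((X * NormedSpace.exp (t • X)) i j) t := by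
  open scoped Matrix.Norms.Operator in
  have h := hasDerivAt_exp_smul_const' (𝕂 := ℝ) X t
  exact (Matrix.entryLinearMap ℝ ℝ i j :
    Matrix (Fin k) (Fin k) ℝ →ₗ[ℝ] ℝ).toContinuousLinearMap.hasFDerivAt.comp_hasDerivAt t h

theorem hasDerivAt_exp_smul_mulVec {k : ℕ} (X : Matrix (Fin k) (Fin k) ℝ) (v : Fin k → ℝ) (t : ℝ) :
    HasDerivAt (fun t : ℝ => NormedSpace.exp (t • X) *ᵥ v)
      (X *ᵥ (NormedSpace.exp (t • X) *ᵥ v)) t := by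
  rw [Matrix.mulVec_mulVec, hasDerivAt_pi]
  intro i
  simp only [Matrix.mulVec, dotProduct]
  exact HasDerivAt.fun_sum fun j _ => (hasDerivAt_exp_smul_apply X i j t).mul_const (v j)

/-- Uniqueness for linear differential equations: an exponential is evaluated on a vector by
exhibiting an integral curve. -/
theorem exp_smul_mulVec_eq {k : ℕ} {X : Matrix (Fin k) (Fin k) ℝ} {γ : ℝ → Fin k → ℝ}
    (h : ∀ t, HasDerivAt γ (X *ᵥ γ t) t) (t : ℝ) : NormedSpace.exp (t • X) *ᵥ γ 0 = γ t := by
  have key := ODE_solution_unique_univ (v := fun _ y => X *ᵥ y) (s := fun _ => Set.univ) (t₀ := 0)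
    (fun _ => (X.mulVecLin.toContinuousLinearMap.lipschitz).lipschitzOnWith)
    (fun t => ⟨hasDerivAt_exp_smul_mulVec X (γ 0) t, trivial⟩) (fun t => ⟨h t, trivial⟩)
    (by simp)
  exact congrFun key t

theorem exp_mulVec_of_eigenvector {k : ℕ} {X : Matrix (Fin k) (Fin k) ℝ} {v : Fin k → ℝ} {r : ℝ}
    (h : X *ᵥ v = r • v) : NormedSpace.exp X *ᵥ v = Real.exp r • v := by
  have := exp_smul_mulVec_eq (X := X) (γ := fun t => Real.exp (t * r) • v) (fun t => by
    have h1 := (((hasDerivAt_id t).mul_const r).exp).smul_const v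
    rw [Matrix.mulVec_smul, h, smul_smul]
    simpa using h1) 1
  simpa using this

theorem exp_mulVec_of_kernel {k : ℕ} {X : Matrix (Fin k) (Fin k) ℝ} {v : Fin k → ℝ}
    (h : X *ᵥ v = 0) : NormedSpace.exp X *ᵥ v = v := by
  have := exp_mulVec_of_eigenvector (X := X) (v := v) (r := 0) (by rw [h, zero_smul])
  simpa using this

theorem exp_mul_exp_neg {k : ℕ} (X : Matrix (Fin k) (Fin k) ℝ) :
    NormedSpace.exp X * NormedSpace.exp (-X) = 1 := by
  rw [← Matrix.exp_add_of_commute _ _ (Commute.refl X).neg_right, add_neg_cancel,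
    NormedSpace.exp_zero]

/-- The matrix exponential as a map into the general linear group. -/
def expGL {k : ℕ} (X : Matrix (Fin k) (Fin k) ℝ) : GL (Fin k) ℝ :=
  ⟨NormedSpace.exp X, NormedSpace.exp (-X), exp_mul_exp_neg X, by
    simpa using exp_mul_exp_neg (-X)⟩

theorem coe_expGL {k : ℕ} (X : Matrix (Fin k) (Fin k) ℝ) :
    (expGL X : Matrix (Fin k) (Fin k) ℝ) = NormedSpace.exp X := rfl

theorem continuous_exp_smul {k : ℕ} (X : Matrix (Fin k) (Fin k) ℝ) :
    Continuous fun t : ℝ => NormedSpace.exp (t • X) :=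
  continuous_matrix fun i j =>
    continuous_iff_continuousAt.mpr fun t => (hasDerivAt_exp_smul_apply X i j t).continuousAt

theorem continuous_expGL_smul {k : ℕ} (X : Matrix (Fin k) (Fin k) ℝ) :
    Continuous fun t : ℝ => expGL (t • X) := by
  refine Units.continuous_iff.mpr ⟨continuous_exp_smul X, ?_⟩
  have := continuous_exp_smul (-X)
  simp only [smul_neg] at this
  exact this

/-! ### Generation of the identity component by exponentials. -/

/-- The left side is the involution of `𝔤𝔩(4, ℝ)` with fixed algebra `𝔰𝔬(1, 3)`. It is the
differential of the involution of the group with fixed group `O(1, 3)`, so membership of `exp X` in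
`O(1, 3)` becomes an equality of two exponentials. -/
theorem eq_conj_neg_transpose_iff (X : Matrix (Fin 4) (Fin 4) ℝ) :
    -(gram * Xᵀ * gram) = X ↔ ∃ c, lorentz c = X := by
  rw [mem_range_lorentz_iff]
  constructor
  · intro h
    nth_rewrite 2 [← h]
    rw [mul_neg, ← mul_assoc, ← mul_assoc, gram_mul_gram, one_mul, add_neg_cancel]
  · intro h
    rw [mul_assoc, eq_neg_of_add_eq_zero_left h, mul_neg, ← mul_assoc, gram_mul_gram, one_mul,
      neg_neg]

theorem exp_conj_neg_transpose (X : Matrix (Fin 4) (Fin 4) ℝ) :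
    NormedSpace.exp (-(gram * Xᵀ * gram)) = gram * (NormedSpace.exp (-X))ᵀ * gram := by
  have h := Matrix.exp_units_conj (⟨gram, gram, gram_mul_gram, gram_mul_gram⟩ : GL (Fin 4) ℝ) (-X)ᵀ
  rw [← Matrix.exp_transpose, ← neg_mul, ← mul_neg, ← Matrix.transpose_neg]
  exact h

theorem mem_O_iff_exp {X : Matrix (Fin 4) (Fin 4) ℝ} {g : GL (Fin 4) ℝ}
    (hg : (g : Matrix (Fin 4) (Fin 4) ℝ) = NormedSpace.exp X) :
    g ∈ O 1 3 ↔ NormedSpace.exp (-(gram * Xᵀ * gram)) = NormedSpace.exp X := by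
  rw [mem_O_iff, hg, exp_conj_neg_transpose]
  have h1 : (NormedSpace.exp (-X))ᵀ * (NormedSpace.exp X)ᵀ = 1 := by
    rw [← Matrix.transpose_mul, exp_mul_exp_neg, Matrix.transpose_one]
  have h2 := mul_eq_one_comm.mp h1
  constructor
  · intro h
    calc gram * (NormedSpace.exp (-X))ᵀ * gram
        = gram * ((NormedSpace.exp (-X))ᵀ * (NormedSpace.exp X)ᵀ) * gram * NormedSpace.exp X := by
          nth_rewrite 2 [← h]
          simp only [mul_assoc]
      _ = NormedSpace.exp X := by rw [h1, mul_one, gram_mul_gram, one_mul]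
  · intro h
    calc (NormedSpace.exp X)ᵀ * gram * NormedSpace.exp X
        = (NormedSpace.exp X)ᵀ * (gram * gram) * (NormedSpace.exp (-X))ᵀ * gram := by
          nth_rewrite 2 [← h]
          simp only [mul_assoc]
      _ = gram := by rw [gram_mul_gram, mul_one, h2, one_mul]

theorem expGL_lorentz_mem_O (c : Fin 3 → ℂ) : expGL (lorentz c) ∈ O 1 3 := by
  rw [mem_O_iff_exp (coe_expGL _), (eq_conj_neg_transpose_iff _).mpr ⟨c, rfl⟩]

theorem _root_.HasDerivAt.mink {γ δ : ℝ → Fin 4 → ℝ} {γ' δ' : Fin 4 → ℝ} {t : ℝ}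
    (hγ : HasDerivAt γ γ' t) (hδ : HasDerivAt δ δ' t) :
    HasDerivAt (fun t => mink (γ t) (δ t)) (mink γ' (δ t) + mink (γ t) δ') t := by
  rw [hasDerivAt_pi] at hγ hδ
  have h : ∀ i, HasDerivAt (fun t => γ t i * δ t i) (γ' i * δ t i + γ t i * δ' i) t :=
    fun i => (hγ i).mul (hδ i)
  simp only [mink_apply]
  refine ((((h 0).fun_neg.fun_add (h 1)).fun_add (h 2)).fun_add (h 3)).congr_deriv ?_
  ring

theorem exists_lorentz_of_forall_exp_mem {X : Matrix (Fin 4) (Fin 4) ℝ}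
    (h : ∀ t : ℝ, expGL (t • X) ∈ O 1 3) : ∃ c, lorentz c = X := by
  have hd : ∀ i j, mink (X *ᵥ (Pi.single i 1)) (Pi.single j 1) +
      mink (Pi.single i 1) (X *ᵥ (Pi.single j 1)) = 0 := by
    intro i j
    have h1 := (hasDerivAt_exp_smul_mulVec X (Pi.single i 1) 0).mink
      (hasDerivAt_exp_smul_mulVec X (Pi.single j 1) 0)
    have h2 : (fun t : ℝ => mink (NormedSpace.exp (t • X) *ᵥ Pi.single i 1)
        (NormedSpace.exp (t • X) *ᵥ Pi.single j 1)) =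
        fun _ => mink (Pi.single i 1) (Pi.single j 1) :=
      funext fun t => (transpose_mul_gram_mul_iff _).mp (mem_O_iff.mp (h t)) _ _
    rw [h2] at h1
    have h3 := h1.unique (hasDerivAt_const 0 _)
    simpa only [zero_smul, NormedSpace.exp_zero, Matrix.one_mulVec] using h3
  rw [mem_range_lorentz_iff]
  ext i j
  have := hd i j
  rw [mink, mink, ← Matrix.vecMul_transpose, ← Matrix.dotProduct_mulVec, Matrix.mulVec_mulVec,
    Matrix.mulVec_mulVec, ← dotProduct_add, ← Matrix.add_mulVec] at this
  simpa using this

theorem expGL_lorentz_mem_SO₀ (c : Fin 3 → ℂ) : expGL (lorentz c) ∈ SO₀ 1 3 := by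
  have hmem : ∀ t : ℝ, expGL (t • lorentz c) ∈ O 1 3 := fun t => by
    rw [← map_smul]
    exact expGL_lorentz_mem_O _
  let f : ℝ → O 1 3 := fun t => ⟨expGL (t • lorentz c), hmem t⟩
  have hf : Continuous f := (continuous_expGL_smul _).subtype_mk _
  have h0 : f 0 = 1 := Subtype.ext (Units.ext (by simp [f, coe_expGL]))
  have h1 : f 1 ∈ connectedComponent (1 : O 1 3) :=
    (isPreconnected_range hf).subset_connectedComponent ⟨0, h0⟩ ⟨1, rfl⟩
  exact ⟨f 1, h1, by simp [f]⟩

theorem SO₀_le_O : SO₀ 1 3 ≤ O 1 3 := by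
  rintro _ ⟨g, -, rfl⟩
  exact g.2

/-- An isometry near `1` is `exp X` with `X` small, and the involution sends `X` to another small
logarithm of the same matrix. Local injectivity of `exp` puts `X` in `𝔰𝔬(1, 3)`. Thus `H` meets
`O(1, 3)` in an open, hence clopen, subgroup. -/
theorem SO₀_le_of_forall_expGL_lorentz_mem {H : Subgroup (GL (Fin 4) ℝ)}
    (hH : ∀ c, expGL (lorentz c) ∈ H) : SO₀ 1 3 ≤ H := by
  have hopen : IsOpen ((H.subgroupOf (O 1 3) : Subgroup (O 1 3)) : Set (O 1 3)) := by
    refine Subgroup.isOpen_of_mem_nhds _ (g := 1) ?_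
    have hloc : ∀ᶠ A in nhds (1 : Matrix (Fin 4) (Fin 4) ℝ), ∃ X, A = NormedSpace.exp X ∧
        (NormedSpace.exp (-(gram * Xᵀ * gram)) = NormedSpace.exp X →
          -(gram * Xᵀ * gram) = X) := by
      open scoped Matrix.Norms.Operator in
      have hs : HasStrictFDerivAt NormedSpace.exp
          ((ContinuousLinearEquiv.refl ℝ (Matrix (Fin 4) (Fin 4) ℝ) :
            Matrix (Fin 4) (Fin 4) ℝ →L[ℝ] Matrix (Fin 4) (Fin 4) ℝ)) 0 :=
        hasStrictFDerivAt_exp_zero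
      let e := hs.toOpenPartialHomeomorph NormedSpace.exp
      have hsource : e.source ∈ nhds (0 : Matrix (Fin 4) (Fin 4) ℝ) :=
        e.open_source.mem_nhds hs.mem_toOpenPartialHomeomorph_source
      have hmap := hs.map_nhds_eq_of_equiv
      rw [NormedSpace.exp_zero] at hmap
      have hcont : Continuous fun X : Matrix (Fin 4) (Fin 4) ℝ => -(gram * Xᵀ * gram) := by
        fun_prop
      have hpre : (fun X : Matrix (Fin 4) (Fin 4) ℝ => -(gram * Xᵀ * gram)) ⁻¹' e.source ∈
          nhds (0 : Matrix (Fin 4) (Fin 4) ℝ) :=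
        hcont.continuousAt.preimage_mem_nhds (by simpa using hsource)
      have himg := hmap.ge (Filter.image_mem_map (Filter.inter_mem hsource hpre))
      filter_upwards [himg]
      rintro _ ⟨X, ⟨hX, hX'⟩, rfl⟩
      exact ⟨X, rfl, fun h => e.injOn hX' hX h⟩
    have hval : Filter.Tendsto (fun g : O 1 3 => ((g : GL (Fin 4) ℝ) : Matrix (Fin 4) (Fin 4) ℝ))
        (nhds 1) (nhds 1) :=
      (Units.continuous_val.comp continuous_subtype_val).tendsto' _ _ rfl
    filter_upwards [hval.eventually hloc]
    rintro g ⟨X, hX, hinj⟩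
    obtain ⟨c, rfl⟩ := (eq_conj_neg_transpose_iff X).mp (hinj ((mem_O_iff_exp hX).mp g.2))
    change (g : GL (Fin 4) ℝ) ∈ H
    rw [show (g : GL (Fin 4) ℝ) = expGL (lorentz c) from Units.ext hX]
    exact hH c
  rintro _ ⟨g, hg, rfl⟩
  have hclopen : IsClopen ((H.subgroupOf (O 1 3) : Subgroup (O 1 3)) : Set (O 1 3)) :=
    ⟨Subgroup.isClosed_of_isOpen _ hopen, hopen⟩
  exact hclopen.connectedComponent_subset (one_mem _) hg

/-! ### Block embeddings and fixed points. -/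

theorem blockMatrixHom_mulVec (k : ℕ) (A : Matrix (Fin k) (Fin k) ℝ) (t : Fin 1 → ℝ)
    (v : Fin k → ℝ) :
    blockMatrixHom k A *ᵥ Fin.append t v = Fin.append t (A *ᵥ v) := by
  ext i
  refine Fin.addCases (fun j => ?_) (fun j => ?_) i
  · obtain rfl : j = 0 := Subsingleton.elim _ _
    simp [blockMatrixHom, Matrix.mulVec, dotProduct, Fin.sum_univ_add]
  · simp [blockMatrixHom, Matrix.mulVec, dotProduct, Fin.sum_univ_add]

theorem append_eq_vecCons (k : ℕ) (t : ℝ) (v : Fin k → ℝ) (i : Fin (k + 1)) :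
    Fin.append (fun _ : Fin 1 => t) v (Fin.cast (add_comm k 1) i) = Matrix.vecCons t v i := by
  refine Fin.cases ?_ (fun j => ?_) i
  · exact Fin.append_left (fun _ : Fin 1 => t) v 0
  · have : Fin.cast (add_comm k 1) j.succ = Fin.natAdd 1 j := Fin.ext (by simp [add_comm])
    rw [this, Fin.append_right, Matrix.cons_val_succ]

theorem blockMatrixHom_three_mulVec (A : Matrix (Fin 3) (Fin 3) ℝ) (t : ℝ) (v : Fin 3 → ℝ) :
    (blockMatrixHom 3 A : Matrix (Fin 4) (Fin 4) ℝ) *ᵥ Matrix.vecCons t v =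
      Matrix.vecCons t (A *ᵥ v) := by
  have e : ∀ w : Fin 3 → ℝ, (Fin.append (fun _ : Fin 1 => t) w : Fin 4 → ℝ) = Matrix.vecCons t w :=
    fun w => funext (append_eq_vecCons 3 t w)
  rw [← e, ← e]
  exact blockMatrixHom_mulVec 3 A (fun _ => t) v

theorem det_blockMatrixHom_three (A : Matrix (Fin 3) (Fin 3) ℝ) :
    (blockMatrixHom 3 A : Matrix (Fin 4) (Fin 4) ℝ).det = A.det := by
  change (Matrix.reindexAlgEquiv ℝ ℝ finSumFinEquiv (Matrix.fromBlocks 1 0 0 A)).det = _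
  rw [Matrix.det_reindexAlgEquiv, Matrix.det_fromBlocks_zero₂₁, Matrix.det_one, one_mul]

theorem blockHom_three_mulVec (h : GL (Fin 3) ℝ) (t : ℝ) (v : Fin 3 → ℝ) :
    ((blockHom 3 h : GL (Fin 4) ℝ) : Matrix (Fin 4) (Fin 4) ℝ) *ᵥ Matrix.vecCons t v =
      Matrix.vecCons t ((h : Matrix (Fin 3) (Fin 3) ℝ) *ᵥ v) :=
  blockMatrixHom_three_mulVec h t v

theorem deSitterHom_mulVec (h : GL (Fin 4) ℝ) (t : ℝ) (v : Fin 4 → ℝ) :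
    (deSitterHom h : Matrix (Fin 5) (Fin 5) ℝ) *ᵥ Matrix.vecCons t v =
      Matrix.vecCons t ((h : Matrix (Fin 4) (Fin 4) ℝ) *ᵥ v) := by
  have e : ∀ w : Fin 4 → ℝ, (Fin.append (fun _ : Fin 1 => t) w : Fin 5 → ℝ) = Matrix.vecCons t w :=
    fun w => funext (append_eq_vecCons 4 t w)
  rw [← e, ← e]
  exact blockMatrixHom_mulVec 4 h (fun _ => t) v

theorem q_two_three_vecCons (t : ℝ) (x : Fin 4 → ℝ) :
    q 2 3 (Matrix.vecCons t x) = -(t * t) + mink x x := by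
  simp [q, QuadraticMap.weightedSumSquares_apply, Fin.sum_univ_succ, mink_apply]
  ring

theorem q_one_three_vecCons (t : ℝ) (v : Fin 3 → ℝ) :
    q 1 3 (Matrix.vecCons t v) = -(t * t) + q 0 3 v := by
  simp [q, QuadraticMap.weightedSumSquares_apply, Fin.sum_univ_succ]

/-- A set of generators of a group, each of which scales `x` by a nonzero factor, acts on `Ein`
with a common fixed point. -/
theorem exists_fixed_point {S : Set (GL (Fin 4) ℝ)} {t : ℝ} {x : Fin 4 → ℝ}
    (hx : x ≠ 0) (hq : mink x x = t * t)
    (hS : ∀ g ∈ S, ∃ r : ℝ, r ≠ 0 ∧ (g : Matrix (Fin 4) (Fin 4) ℝ) *ᵥ x = r • x ∧ t = r * t) :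
    ∃ p ∈ Ein, ∀ g ∈ Subgroup.closure S, deSitterHom g • p = p := by
  have hne : Matrix.vecCons t x ≠ 0 := fun e => hx <| by
    ext i
    simpa using congrFun e i.succ
  refine ⟨Projectivization.mk ℝ (Matrix.vecCons t x) hne, ?_, ?_⟩
  · intro v hv
    rw [Projectivization.submodule_mk, Submodule.mem_span_singleton] at hv
    obtain ⟨a, rfl⟩ := hv
    rw [QuadraticMap.map_smul, q_two_three_vecCons, hq]
    simp
  · have hle : Subgroup.closure S ≤
        (MulAction.stabilizer (GL (Fin 5) ℝ)
          (Projectivization.mk ℝ (Matrix.vecCons t x) hne)).comap deSitterHom := by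
      rw [Subgroup.closure_le]
      intro g hg
      obtain ⟨r, hr, hgx, ht⟩ := hS g hg
      change deSitterHom g • _ = _
      rw [Projectivization.smul_mk, Projectivization.mk_eq_mk_iff']
      refine ⟨r, ?_⟩
      change _ = (deSitterHom g : Matrix (Fin 5) (Fin 5) ℝ) *ᵥ Matrix.vecCons t x
      rw [deSitterHom_mulVec, hgx, Matrix.smul_cons, smul_eq_mul, ← ht]
    exact fun g hg => hle hg

/-- Write `m = u + I w`; nullity says that `u` and `w` are orthogonal of equal length, so `v = u ×
w` completes an orthogonal frame and `x = (u · u, v)` is null. The equation `m · c = 0` says that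
the rotation part of `c` moves `v` by exactly minus the component across `v` of the displacement due
to the boost part, so only a multiple of `x` remains. -/
theorem exists_null_eigenvector {m : Fin 3 → ℂ} (hm : m ≠ 0) (hmm : m ⬝ᵥ m = 0) :
    ∃ x : Fin 4 → ℝ, x ≠ 0 ∧ mink x x = 0 ∧
      ∀ c, m ⬝ᵥ c = 0 → ∃ r : ℝ, lorentz c *ᵥ x = r • x := by
  set u := reVec m with hu
  set w := imVec m with hw
  have hre : ∀ c, (m ⬝ᵥ c).re = u ⬝ᵥ reVec c - w ⬝ᵥ imVec c := fun c => by
    simp [dotProduct, Fin.sum_univ_three, reVec_apply, imVec_apply, hu, hw]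
    ring
  have him : ∀ c, (m ⬝ᵥ c).im = u ⬝ᵥ imVec c + w ⬝ᵥ reVec c := dotProduct_im m
  have huw : u ⬝ᵥ w = 0 := by
    have := him m
    rw [hmm, ← hu, ← hw, dotProduct_comm w u, Complex.zero_im] at this
    linarith
  have hww : w ⬝ᵥ w = u ⬝ᵥ u := by
    have := hre m
    rw [hmm, ← hu, ← hw, Complex.zero_re] at this
    linarith
  have huu : u ⬝ᵥ u ≠ 0 := by
    intro h0
    have hu0 := dotProduct_self_eq_zero.mp h0
    have hw0 := dotProduct_self_eq_zero.mp (hww.trans h0)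
    refine hm (funext fun i => Complex.ext ?_ ?_)
    · exact congrFun hu0 i
    · exact congrFun hw0 i
  set v := u ⨯₃ w with hv
  have hvv : v ⬝ᵥ v = (u ⬝ᵥ u) * (u ⬝ᵥ u) := by
    rw [hv, cross_dot_cross, hww, huw]
    ring
  refine ⟨Matrix.vecCons (u ⬝ᵥ u) v, fun e => huu ?_, ?_, fun c hc => ?_⟩
  · simpa using congrFun e 0
  · rw [mink_apply]
    have : v ⬝ᵥ v = v 0 * v 0 + v 1 * v 1 + v 2 * v 2 := by
      simp [dotProduct, Fin.sum_univ_three]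
    simp only [Matrix.cons_val_zero, Matrix.cons_val_one, Matrix.cons_val]
    linarith
  · set a := imVec c
    set b := reVec c
    have h1 : u ⬝ᵥ b = w ⬝ᵥ a := by
      have := hre c
      rw [hc, Complex.zero_re] at this
      linarith
    have h2 : w ⬝ᵥ b = -(u ⬝ᵥ a) := by
      have := him c
      rw [hc, Complex.zero_im] at this
      linarith
    have h3 : v ⨯₃ u = (u ⬝ᵥ u) • w := by
      rw [← cross_anticomm, hv, cross_cross_eq, huw]
      simp
    have h4 : v ⨯₃ w = -((u ⬝ᵥ u) • u) := by
      rw [← cross_anticomm, hv, cross_cross_eq, hww, dotProduct_comm w u, huw]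
      simp
    have h5 : (u ⬝ᵥ u) • ((u ⬝ᵥ u) • a + b ⨯₃ v) = (a ⬝ᵥ v) • v := by
      have h6 : v ⨯₃ (a ⨯₃ v) = (u ⬝ᵥ u) • ((w ⬝ᵥ a) • w + (u ⬝ᵥ a) • u) := by
        nth_rewrite 2 [hv]
        rw [cross_cross_eq a, map_sub, LinearMap.map_smul, LinearMap.map_smul, h3, h4,
          dotProduct_comm a w, dotProduct_comm a u]
        module
      rw [cross_cross_eq, hvv, dotProduct_comm v a] at h6
      have h7 : b ⨯₃ v = -((w ⬝ᵥ a) • w + (u ⬝ᵥ a) • u) := by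
        rw [hv, cross_cross_eq, dotProduct_comm b w, dotProduct_comm b u, h1, h2]
        module
      rw [h7, smul_add, smul_neg, ← h6]
      module
    refine ⟨(a ⬝ᵥ v) / (u ⬝ᵥ u), ?_⟩
    rw [lorentz_mulVec, Matrix.smul_cons, smul_eq_mul, div_mul_cancel₀ _ huu, div_eq_inv_mul,
      mul_smul, ← h5, inv_smul_smul₀ huu]

/-! ### Rotations, and `SO(3)` as the stabilizer of the time axis. -/

/-- The unit timelike vector fixed by `SO3`. -/
def timeAxis : Fin 4 → ℝ := ![1, 0, 0, 0]

/-- The subgroup of `SO_∘(1, 3)` generated by the infinitesimal rotations. -/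
def rotationGroup : Subgroup (GL (Fin 4) ℝ) :=
  Subgroup.closure {g | ∃ c, lorentz c *ᵥ timeAxis = 0 ∧ g = expGL (lorentz c)}

theorem exists_rotation_one (x : Fin 4 → ℝ) :
    ∃ θ : ℝ, NormedSpace.exp (lorentz (θ • Pi.single 0 1)) *ᵥ x =
      ![x 0, x 1, √(x 2 ^ 2 + x 3 ^ 2), 0] := by
  let z : ℂ := ⟨x 2, x 3⟩
  have hz : ‖z‖ = √(x 2 ^ 2 + x 3 ^ 2) := by rw [Complex.norm_def, Complex.normSq_mk, sq, sq]
  have h := exp_smul_mulVec_eq (X := lorentz (Pi.single 0 1))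
    (γ := fun t => ![x 0, x 1, ‖z‖ * Real.cos (z.arg + t), ‖z‖ * Real.sin (z.arg + t)])
    (fun t => by
      rw [hasDerivAt_pi]
      have h1 : HasDerivAt (fun t : ℝ => z.arg + t) 1 t := (hasDerivAt_id t).const_add _
      intro i
      fin_cases i
      · simpa [lorentz, Matrix.vecHead, Matrix.vecTail] using hasDerivAt_const t (x 0)
      · simpa [lorentz, Matrix.vecHead, Matrix.vecTail] using hasDerivAt_const t (x 1)
      · simpa [lorentz, Matrix.vecHead, Matrix.vecTail] using h1.cos.const_mul ‖z‖
      · simpa [lorentz, Matrix.vecHead, Matrix.vecTail] using h1.sin.const_mul ‖z‖) (-z.arg)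
  refine ⟨-z.arg, ?_⟩
  have h0 : ![x 0, x 1, ‖z‖ * Real.cos (z.arg + 0), ‖z‖ * Real.sin (z.arg + 0)] = x := by
    rw [add_zero, Complex.norm_mul_cos_arg, Complex.norm_mul_sin_arg]
    ext i
    fin_cases i <;> rfl
  rw [h0] at h
  rw [map_smul, h, ← hz]
  simp

theorem exists_rotation_three (x : Fin 4 → ℝ) :
    ∃ θ : ℝ, NormedSpace.exp (lorentz (θ • Pi.single 2 1)) *ᵥ x =
      ![x 0, √(x 1 ^ 2 + x 2 ^ 2), 0, x 3] := by
  let z : ℂ := ⟨x 1, x 2⟩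
  have hz : ‖z‖ = √(x 1 ^ 2 + x 2 ^ 2) := by rw [Complex.norm_def, Complex.normSq_mk, sq, sq]
  have h := exp_smul_mulVec_eq (X := lorentz (Pi.single 2 1))
    (γ := fun t => ![x 0, ‖z‖ * Real.cos (z.arg + t), ‖z‖ * Real.sin (z.arg + t), x 3])
    (fun t => by
      rw [hasDerivAt_pi]
      have h1 : HasDerivAt (fun t : ℝ => z.arg + t) 1 t := (hasDerivAt_id t).const_add _
      intro i
      fin_cases i
      · simpa [lorentz, Matrix.vecHead, Matrix.vecTail] using hasDerivAt_const t (x 0)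
      · simpa [lorentz, Matrix.vecHead, Matrix.vecTail] using h1.cos.const_mul ‖z‖
      · simpa [lorentz, Matrix.vecHead, Matrix.vecTail] using h1.sin.const_mul ‖z‖
      · simpa [lorentz, Matrix.vecHead, Matrix.vecTail] using hasDerivAt_const t (x 3)) (-z.arg)
  refine ⟨-z.arg, ?_⟩
  have h0 : ![x 0, ‖z‖ * Real.cos (z.arg + 0), ‖z‖ * Real.sin (z.arg + 0), x 3] = x := by
    rw [add_zero, Complex.norm_mul_cos_arg, Complex.norm_mul_sin_arg]
    ext i
    fin_cases i <;> rfl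
  rw [h0] at h
  rw [map_smul, h, ← hz]
  simp

theorem exp_boost_timeAxis (s : ℝ) :
    NormedSpace.exp (lorentz (s • Pi.single 0 Complex.I)) *ᵥ timeAxis =
      ![Real.cosh s, Real.sinh s, 0, 0] := by
  have h := exp_smul_mulVec_eq (X := lorentz (Pi.single 0 Complex.I))
    (γ := fun t => ![Real.cosh t, Real.sinh t, 0, 0])
    (fun t => by
      rw [hasDerivAt_pi]
      intro i
      fin_cases i
      · simpa [lorentz, Matrix.vecHead, Matrix.vecTail] using Real.hasDerivAt_cosh t
      · simpa [lorentz, Matrix.vecHead, Matrix.vecTail] using Real.hasDerivAt_sinh t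
      · simpa [lorentz, Matrix.vecHead, Matrix.vecTail] using hasDerivAt_const t (0 : ℝ)
      · simpa [lorentz, Matrix.vecHead, Matrix.vecTail] using hasDerivAt_const t (0 : ℝ)) s
  rw [map_smul, ← h, timeAxis, Real.cosh_zero, Real.sinh_zero]

theorem expGL_mem_rotationGroup {c : Fin 3 → ℂ} (hc : lorentz c *ᵥ timeAxis = 0) :
    expGL (lorentz c) ∈ rotationGroup :=
  Subgroup.subset_closure ⟨c, hc, rfl⟩

theorem lorentz_real_mulVec_timeAxis (θ : ℝ) (i : Fin 3) :
    lorentz (θ • Pi.single i 1) *ᵥ timeAxis = 0 := by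
  ext j
  fin_cases i <;> fin_cases j <;>
    simp [lorentz, timeAxis, Matrix.mulVec, dotProduct, Fin.sum_univ_succ]

theorem exists_mem_rotationGroup_mulVec (x : Fin 4 → ℝ) :
    ∃ k ∈ rotationGroup, ∃ ρ : ℝ, 0 ≤ ρ ∧
      (k : Matrix (Fin 4) (Fin 4) ℝ) *ᵥ x = ![x 0, ρ, 0, 0] := by
  obtain ⟨θ, hθ⟩ := exists_rotation_one x
  obtain ⟨φ, hφ⟩ := exists_rotation_three ![x 0, x 1, √(x 2 ^ 2 + x 3 ^ 2), 0]
  refine ⟨_, mul_mem (expGL_mem_rotationGroup (lorentz_real_mulVec_timeAxis φ 2))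
    (expGL_mem_rotationGroup (lorentz_real_mulVec_timeAxis θ 0)),
    √(x 1 ^ 2 + √(x 2 ^ 2 + x 3 ^ 2) ^ 2), Real.sqrt_nonneg _, ?_⟩
  rw [Units.val_mul, ← Matrix.mulVec_mulVec, coe_expGL, coe_expGL, hθ, hφ]
  rfl

theorem coe_mulVec_inv_mulVec {k : ℕ} (g : GL (Fin k) ℝ) (x : Fin k → ℝ) :
    ((g⁻¹ : GL (Fin k) ℝ) : Matrix (Fin k) (Fin k) ℝ) *ᵥ ((g : Matrix (Fin k) (Fin k) ℝ) *ᵥ x) =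
      x := by
  rw [Matrix.mulVec_mulVec, ← Units.val_mul, inv_mul_cancel, Units.val_one, Matrix.one_mulVec]

theorem det_exp_pos {k : ℕ} (X : Matrix (Fin k) (Fin k) ℝ) : 0 < (NormedSpace.exp X).det := by
  have h : ∀ Y : Matrix (Fin k) (Fin k) ℝ, 0 < (NormedSpace.exp (Y + Y)).det := fun Y => by
    rw [Matrix.exp_add_of_commute _ _ (Commute.refl _), Matrix.det_mul]
    exact mul_self_pos.mpr (Matrix.det_ne_zero_of_right_inverse (exp_mul_exp_neg Y))
  -- `exp X` is the square of the invertible matrix `exp (X / 2)`.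
  have hX : X = (1 / 2 : ℝ) • X + (1 / 2 : ℝ) • X := by
    rw [← add_smul, add_halves, one_smul]
  rw [hX]
  exact h _

theorem det_sq_of_mem_O {g : GL (Fin 4) ℝ} (hg : g ∈ O 1 3) :
    (g : Matrix (Fin 4) (Fin 4) ℝ).det ^ 2 = 1 := by
  have h := congrArg Matrix.det (mem_O_iff.mp hg)
  have h0 : gram.det ≠ 0 := by
    intro h0
    have := congrArg Matrix.det gram_mul_gram
    rw [Matrix.det_mul, h0] at this
    simp at this
  rw [Matrix.det_mul, Matrix.det_mul, Matrix.det_transpose] at h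
  have h1 : gram.det * ((g : Matrix (Fin 4) (Fin 4) ℝ).det ^ 2 - 1) = 0 := by linear_combination h
  linarith [(mul_eq_zero.mp h1).resolve_left h0]

/-- The subgroup of isometries of determinant one that fix `timeAxis`. -/
def timeAxisStabilizer : Subgroup (GL (Fin 4) ℝ) :=
  O 1 3 ⊓ MulAction.stabilizer _ timeAxis ⊓ (Matrix.GeneralLinearGroup.det).ker

theorem mem_timeAxisStabilizer_iff {g : GL (Fin 4) ℝ} :
    g ∈ timeAxisStabilizer ↔ g ∈ O 1 3 ∧ (g : Matrix (Fin 4) (Fin 4) ℝ) *ᵥ timeAxis = timeAxis ∧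
      (g : Matrix (Fin 4) (Fin 4) ℝ).det = 1 := by
  rw [timeAxisStabilizer, Subgroup.mem_inf, Subgroup.mem_inf, and_assoc, MonoidHom.mem_ker,
    Units.ext_iff]
  rfl

theorem rotationGroup_le : rotationGroup ≤ timeAxisStabilizer := by
  rw [rotationGroup, Subgroup.closure_le]
  rintro _ ⟨c, hc, rfl⟩
  refine mem_timeAxisStabilizer_iff.mpr ⟨expGL_lorentz_mem_O c, exp_mulVec_of_kernel hc, ?_⟩
  have h1 := det_sq_of_mem_O (expGL_lorentz_mem_O c)
  have h2 := det_exp_pos (lorentz c)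
  rw [coe_expGL] at h1 ⊢
  nlinarith

theorem rotationGroup_le_SO₀ : rotationGroup ≤ SO₀ 1 3 := by
  rw [rotationGroup, Subgroup.closure_le]
  rintro _ ⟨c, -, rfl⟩
  exact expGL_lorentz_mem_SO₀ c

theorem mink_mulVec_of_mem_O {g : GL (Fin 4) ℝ} (hg : g ∈ O 1 3) (x y : Fin 4 → ℝ) :
    mink ((g : Matrix (Fin 4) (Fin 4) ℝ) *ᵥ x) ((g : Matrix (Fin 4) (Fin 4) ℝ) *ᵥ y) = mink x y :=
  (transpose_mul_gram_mul_iff _).mp (mem_O_iff.mp hg) x y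

theorem mulVec_zero_of_mulVec_timeAxis {g : GL (Fin 4) ℝ} (hg : g ∈ O 1 3)
    (ht : (g : Matrix (Fin 4) (Fin 4) ℝ) *ᵥ timeAxis = timeAxis) (x : Fin 4 → ℝ) :
    ((g : Matrix (Fin 4) (Fin 4) ℝ) *ᵥ x) 0 = x 0 := by
  have := mink_mulVec_of_mem_O hg timeAxis x
  rw [ht] at this
  simpa [mink_apply, timeAxis] using this

/-- Euler angles: one product of rotations brings the image of the first spatial axis back, a
rotation about that axis brings the second one back, and the determinant then fixes the third. -/
theorem timeAxisStabilizer_le : timeAxisStabilizer ≤ rotationGroup := by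
  have hdot : ∀ {g : GL (Fin 4) ℝ}, g ∈ timeAxisStabilizer → ∀ x y,
      mink ((g : Matrix (Fin 4) (Fin 4) ℝ) *ᵥ x) ((g : Matrix (Fin 4) (Fin 4) ℝ) *ᵥ y) = mink x y :=
    fun hg => mink_mulVec_of_mem_O (mem_timeAxisStabilizer_iff.mp hg).1
  have hzero : ∀ {g : GL (Fin 4) ℝ}, g ∈ timeAxisStabilizer → ∀ x : Fin 4 → ℝ,
      ((g : Matrix (Fin 4) (Fin 4) ℝ) *ᵥ x) 0 = x 0 := fun hg =>
    mulVec_zero_of_mulVec_timeAxis (mem_timeAxisStabilizer_iff.mp hg).1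
      (mem_timeAxisStabilizer_iff.mp hg).2.1
  intro g hg
  obtain ⟨k, hk, ρ, hρ, hk1⟩ :=
    exists_mem_rotationGroup_mulVec ((g : Matrix (Fin 4) (Fin 4) ℝ) *ᵥ ![0, 1, 0, 0])
  have hg' := mul_mem (rotationGroup_le hk) hg
  rw [Matrix.mulVec_mulVec, ← Units.val_mul] at hk1
  set g₁ := k * g with hg₁
  have h1 : (g₁ : Matrix (Fin 4) (Fin 4) ℝ) *ᵥ ![0, 1, 0, 0] = ![0, 1, 0, 0] := by
    have e0 := hzero hg' ![0, 1, 0, 0]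
    have e1 := hdot hg' ![0, 1, 0, 0] ![0, 1, 0, 0]
    rw [hzero hg] at hk1
    rw [hk1] at e1 ⊢
    simp [mink_apply] at e1
    have : ρ = 1 := by nlinarith
    rw [this]
    rfl
  obtain ⟨θ, hθ⟩ := exists_rotation_one ((g₁ : Matrix (Fin 4) (Fin 4) ℝ) *ᵥ ![0, 0, 1, 0])
  set l := expGL (lorentz (θ • Pi.single 0 1)) with hl
  have hlmem : l ∈ rotationGroup := expGL_mem_rotationGroup (lorentz_real_mulVec_timeAxis θ 0)
  have hg'' := mul_mem (rotationGroup_le hlmem) hg'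
  rw [← coe_expGL, ← hl, Matrix.mulVec_mulVec, ← Units.val_mul] at hθ
  set g₂ := l * g₁ with hg₂
  have h2 : (g₂ : Matrix (Fin 4) (Fin 4) ℝ) *ᵥ ![0, 1, 0, 0] = ![0, 1, 0, 0] := by
    rw [hg₂, Units.val_mul, ← Matrix.mulVec_mulVec, h1, hl, coe_expGL]
    refine exp_mulVec_of_kernel ?_
    ext j
    fin_cases j <;> simp [lorentz, Matrix.mulVec, dotProduct, Fin.sum_univ_succ]
  have h3 : (g₂ : Matrix (Fin 4) (Fin 4) ℝ) *ᵥ ![0, 0, 1, 0] = ![0, 0, 1, 0] := by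
    have e0 := hzero hg' ![0, 0, 1, 0]
    have e1 := hdot hg' ![0, 1, 0, 0] ![0, 0, 1, 0]
    have e2 := hdot hg'' ![0, 0, 1, 0] ![0, 0, 1, 0]
    rw [h1] at e1
    simp only [mink_apply] at e1
    simp at e0 e1
    rw [e0, e1] at hθ
    rw [hθ] at e2 ⊢
    simp only [mink_apply] at e2
    have hnn := Real.sqrt_nonneg (((g₁ : Matrix (Fin 4) (Fin 4) ℝ) *ᵥ ![0, 0, 1, 0]) 2 ^ 2 +
      ((g₁ : Matrix (Fin 4) (Fin 4) ℝ) *ᵥ ![0, 0, 1, 0]) 3 ^ 2)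
    set ρ' := √(((g₁ : Matrix (Fin 4) (Fin 4) ℝ) *ᵥ ![0, 0, 1, 0]) 2 ^ 2 +
      ((g₁ : Matrix (Fin 4) (Fin 4) ℝ) *ᵥ ![0, 0, 1, 0]) 3 ^ 2)
    simp at e2
    have : ρ' = 1 := by nlinarith
    rw [this]
  have h4 : g₂ = 1 := by
    have e0 := hzero hg'' ![0, 0, 0, 1]
    have e1 := hdot hg'' ![0, 1, 0, 0] ![0, 0, 0, 1]
    have e2 := hdot hg'' ![0, 0, 1, 0] ![0, 0, 0, 1]
    have et := (mem_timeAxisStabilizer_iff.mp hg'').2.1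
    have hdet := (mem_timeAxisStabilizer_iff.mp hg'').2.2
    rw [h2] at e1
    rw [h3] at e2
    simp only [mink_apply] at e1 e2
    have hdiag : (g₂ : Matrix (Fin 4) (Fin 4) ℝ) =
        Matrix.diagonal ![1, 1, 1, (g₂ : Matrix (Fin 4) (Fin 4) ℝ) 3 3] := by
      simp [Matrix.mulVec, dotProduct, Fin.sum_univ_succ] at e0 e1 e2
      ext i j
      have c0 := congrFun et i
      have c1 := congrFun h2 i
      have c2 := congrFun h3 i
      simp [Matrix.mulVec, dotProduct, Fin.sum_univ_succ, timeAxis] at c0 c1 c2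
      fin_cases i <;> fin_cases j <;> simp at c0 c1 c2 ⊢ <;> assumption
    refine Units.ext ?_
    rw [hdiag, Matrix.det_diagonal] at hdet
    simp [Fin.prod_univ_succ] at hdet
    rw [hdiag, hdet, Units.val_one, ← Matrix.diagonal_one]
    congr 1
    ext i
    fin_cases i <;> rfl
  have h5 : g = k⁻¹ * (l⁻¹ * g₂) := by rw [hg₂, hg₁]; group
  rw [h5, h4]
  exact mul_mem (inv_mem hk) (mul_mem (inv_mem hlmem) (one_mem _))

theorem SO3_eq : SO3 = timeAxisStabilizer := by
  have htime : timeAxis = Matrix.vecCons 1 0 := by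
    ext i
    fin_cases i <;> rfl
  ext g
  rw [mem_timeAxisStabilizer_iff]
  constructor
  · rintro ⟨h, ⟨hO, hdet⟩, rfl⟩
    refine ⟨fun x => ?_, ?_, ?_⟩
    · rw [← Matrix.cons_head_tail x]
      change q 1 3 (((blockHom 3 h : GL (Fin 4) ℝ) : Matrix (Fin 4) (Fin 4) ℝ) *ᵥ _) = _
      rw [blockHom_three_mulVec, q_one_three_vecCons, q_one_three_vecCons]
      exact congrArg _ (hO _)
    · rw [htime, blockHom_three_mulVec, Matrix.mulVec_zero]
    · have hdet' : (h : Matrix (Fin 3) (Fin 3) ℝ).det = 1 := congrArg Units.val hdet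
      exact (det_blockMatrixHom_three h).trans hdet'
  · rintro ⟨hO, ht, hdet⟩
    set A : Matrix (Fin 4) (Fin 4) ℝ := g.val
    have hrow : ∀ x : Fin 4 → ℝ, (A *ᵥ x) 0 = x 0 := mulVec_zero_of_mulVec_timeAxis hO ht
    have hblock : ∀ (t : ℝ) (v : Fin 3 → ℝ), A *ᵥ Matrix.vecCons t v =
        Matrix.vecCons t (A.submatrix Fin.succ Fin.succ *ᵥ v) := by
      intro t v
      ext i
      refine Fin.cases ?_ (fun j => ?_) i
      · rw [hrow]
        rfl
      · have h1 := congrFun ht j.succ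
        simp only [Matrix.mulVec, dotProduct, Fin.sum_univ_succ (n := 3), timeAxis,
          Matrix.cons_val_zero, Matrix.cons_val_succ, Matrix.submatrix_apply] at h1 ⊢
        have h2 : A j.succ 0 = 0 := by
          fin_cases j <;> simpa [Fin.sum_univ_succ] using h1
        rw [h2, zero_mul, zero_add]
    have hAblock : A = (blockMatrixHom 3 (A.submatrix Fin.succ Fin.succ) :
        Matrix (Fin 4) (Fin 4) ℝ) := by
      refine Matrix.mulVec_injective (funext fun x => ?_)
      rw [← Matrix.cons_head_tail x, hblock, blockMatrixHom_three_mulVec]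
    have hdet' : (A.submatrix Fin.succ Fin.succ).det = 1 := by
      rw [← det_blockMatrixHom_three, ← hAblock, hdet]
    let h : GL (Fin 3) ℝ :=
      Matrix.GeneralLinearGroup.mkOfDetNeZero (A.submatrix Fin.succ Fin.succ) (by simp [hdet'])
    refine ⟨h, ⟨fun v => ?_, Units.ext hdet'⟩, Units.ext hAblock.symm⟩
    have h1 := hO (Matrix.vecCons 0 v)
    change q 1 3 (A *ᵥ _) = _ at h1
    rw [hblock, q_one_three_vecCons, q_one_three_vecCons] at h1
    exact add_left_cancel h1

/-- After a rotation `x` lies in the plane of the time axis and the first spatial axis, on the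
branch `(cosh s, sinh s)`, which a boost reaches from the time axis. -/
theorem exists_mem_SO₀_mulVec_timeAxis {x : Fin 4 → ℝ} (hx : mink x x = -1) (h0 : 0 < x 0) :
    ∃ c ∈ SO₀ 1 3, (c : Matrix (Fin 4) (Fin 4) ℝ) *ᵥ timeAxis = x := by
  obtain ⟨k, hk, ρ, hρ, hkx⟩ := exists_mem_rotationGroup_mulVec x
  refine ⟨k⁻¹ * expGL (lorentz (Real.arsinh ρ • Pi.single 0 Complex.I)),
    mul_mem (inv_mem (rotationGroup_le_SO₀ hk)) (expGL_lorentz_mem_SO₀ _), ?_⟩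
  have h1 : mink ![x 0, ρ, 0, 0] ![x 0, ρ, 0, 0] = -1 := by
    rw [← hkx, (transpose_mul_gram_mul_iff _).mp (mem_O_iff.mp (SO₀_le_O (rotationGroup_le_SO₀ hk))),
      hx]
  have h2 : Real.cosh (Real.arsinh ρ) = x 0 := by
    rw [Real.cosh_arsinh, Real.sqrt_eq_iff_mul_self_eq (by positivity) h0.le]
    simp [mink_apply] at h1
    linarith
  rw [Units.val_mul, ← Matrix.mulVec_mulVec, coe_expGL, exp_boost_timeAxis, h2, Real.sinh_arsinh,
    ← hkx, coe_mulVec_inv_mulVec]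

/-! ### From subalgebras to the groups they generate. -/

theorem exists_fixed_point_of_eigenvector {𝔥 : Set (Fin 3 → ℂ)} {x : Fin 4 → ℝ} (hx : x ≠ 0)
    (hq : mink x x = 0) (h : ∀ c ∈ 𝔥, ∃ r : ℝ, lorentz c *ᵥ x = r • x) :
    ∃ p ∈ Ein, ∀ g ∈ Subgroup.closure ((fun c => expGL (lorentz c)) '' 𝔥),
      deSitterHom g • p = p := by
  refine exists_fixed_point (t := 0) hx (by rw [hq, mul_zero]) ?_
  rintro _ ⟨c, hc, rfl⟩
  obtain ⟨r, hr⟩ := h c hc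
  exact ⟨Real.exp r, Real.exp_ne_zero r, exp_mulVec_of_eigenvector hr, (mul_zero _).symm⟩

theorem exists_fixed_point_of_kernel {𝔥 : Set (Fin 3 → ℂ)} {x : Fin 4 → ℝ} (hx : x ≠ 0)
    (hq : 0 ≤ mink x x) (h : ∀ c ∈ 𝔥, lorentz c *ᵥ x = 0) :
    ∃ p ∈ Ein, ∀ g ∈ Subgroup.closure ((fun c => expGL (lorentz c)) '' 𝔥),
      deSitterHom g • p = p := by
  refine exists_fixed_point (t := √(mink x x)) hx (Real.mul_self_sqrt hq).symm ?_
  rintro _ ⟨c, hc, rfl⟩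
  refine ⟨1, one_ne_zero, ?_, (one_mul _).symm⟩
  rw [one_smul]
  exact exp_mulVec_of_kernel (h c hc)

theorem mink_smul_smul (r : ℝ) (x : Fin 4 → ℝ) : mink (r • x) (r • x) = r ^ 2 * mink x x := by
  simp only [mink_apply, Pi.smul_apply, smul_eq_mul]
  ring

theorem exists_unit_timelike_multiple {x : Fin 4 → ℝ} (hx : mink x x < 0) :
    ∃ r : ℝ, mink (r • x) (r • x) = -1 ∧ 0 < (r • x) 0 := by
  have h0 : x 0 ≠ 0 := by
    intro h0
    rw [mink_apply, h0] at hx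
    nlinarith [mul_self_nonneg (x 1), mul_self_nonneg (x 2), mul_self_nonneg (x 3)]
  have hs : √(-mink x x) ^ 2 = -mink x x := Real.sq_sqrt (by linarith)
  have hs0 : 0 < √(-mink x x) := Real.sqrt_pos.mpr (by linarith)
  have hr : ∀ r : ℝ, r ^ 2 = ((√(-mink x x))⁻¹) ^ 2 → mink (r • x) (r • x) = -1 := by
    intro r hr
    rw [mink_smul_smul, hr, inv_pow, hs, inv_neg, neg_mul, inv_mul_cancel₀ hx.ne]
  rcases lt_or_gt_of_ne h0 with h | h
  · exact ⟨-(√(-mink x x))⁻¹, hr _ (neg_sq _), by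
      rw [Pi.smul_apply, smul_eq_mul]
      exact mul_pos_of_neg_of_neg (neg_neg_of_pos (inv_pos.mpr hs0)) h⟩
  · exact ⟨(√(-mink x x))⁻¹, hr _ rfl, mul_pos (inv_pos.mpr hs0) h⟩

/-- The stabilizer of a timelike vector is totally real. The equations for `c` and `I • c` combine
to `(t² - v · v) a = 0` for each of the real and imaginary parts, and the factor is nonzero for
timelike `(t, v)`. -/
theorem lorentz_I_smul_eq_zero {c : Fin 3 → ℂ} {x : Fin 4 → ℝ} (hq : mink x x < 0)
    (h1 : lorentz c *ᵥ x = 0) (h2 : lorentz (Complex.I • c) *ᵥ x = 0) : c = 0 := by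
  obtain ⟨t, v, rfl⟩ : ∃ t v, x = Matrix.vecCons t v := ⟨_, _, (Matrix.cons_head_tail x).symm⟩
  have hre : reVec (Complex.I • c) = -imVec c := by ext i; simp [reVec_apply, imVec_apply]
  have him : imVec (Complex.I • c) = reVec c := by ext i; simp [reVec_apply, imVec_apply]
  have split : ∀ c, lorentz c *ᵥ Matrix.vecCons t v = 0 →
      imVec c ⬝ᵥ v = 0 ∧ t • imVec c + reVec c ⨯₃ v = 0 := by
    intro c hc
    rw [lorentz_mulVec] at hc
    refine ⟨by simpa using congrFun hc 0, ?_⟩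
    ext i
    simpa using congrFun hc i.succ
  obtain ⟨h3, h4⟩ := split _ h1
  obtain ⟨h5, h6⟩ := split _ h2
  rw [him] at h5 h6
  rw [hre] at h6
  have hvv : mink (Matrix.vecCons t v) (Matrix.vecCons t v) = v ⬝ᵥ v - t * t := by
    simp [mink_apply, dotProduct, Fin.sum_univ_three]
    ring
  have hne : t * t - v ⬝ᵥ v ≠ 0 := by
    intro h
    rw [hvv] at hq
    linarith
  have key : ∀ a b : Fin 3 → ℝ, a ⬝ᵥ v = 0 → t • a + b ⨯₃ v = 0 → t • b - a ⨯₃ v = 0 → a = 0 := by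
    intro a b ha hab hba
    have e : (t * t - v ⬝ᵥ v) • a = t • (t • a + b ⨯₃ v) - (t • b - a ⨯₃ v) ⨯₃ v - (a ⬝ᵥ v) • v := by
      have := cross_cross_eq_smul_sub_smul a v v
      rw [LinearMap.map_sub₂, this, LinearMap.map_smul₂]
      module
    rw [ha, hab, hba] at e
    refine (smul_eq_zero.mp (e.trans ?_)).resolve_left hne
    simp
  have hneg : (-imVec c) ⨯₃ v = -(imVec c ⨯₃ v) := by rw [LinearMap.map_neg₂]
  rw [hneg, ← sub_eq_add_neg] at h6
  have ha := key _ _ h3 h4 h6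
  have hb : reVec c = 0 := by
    refine neg_eq_zero.mp (key (-reVec c) (imVec c) (by rw [neg_dotProduct, h5, neg_zero]) ?_ ?_)
    · rw [smul_neg, ← neg_eq_zero, neg_add, neg_neg, ← sub_eq_add_neg, h6]
    · rw [LinearMap.map_neg₂, sub_neg_eq_add, h4]
  exact funext fun i => Complex.ext (congrFun hb i) (congrFun ha i)

theorem conj_lorentz {c : GL (Fin 4) ℝ} (hc : c ∈ O 1 3) (y : Fin 3 → ℂ) :
    ∃ z, lorentz z = (c : Matrix (Fin 4) (Fin 4) ℝ) * lorentz y * ((c⁻¹ : GL (Fin 4) ℝ) :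
      Matrix (Fin 4) (Fin 4) ℝ) ∧ expGL (lorentz z) = c * expGL (lorentz y) * c⁻¹ := by
  have hexp : ∀ Y, expGL ((c : Matrix (Fin 4) (Fin 4) ℝ) * Y * ((c⁻¹ : GL (Fin 4) ℝ) :
      Matrix (Fin 4) (Fin 4) ℝ)) = c * expGL Y * c⁻¹ := fun Y =>
    Units.ext (Matrix.exp_units_conj c Y)
  obtain ⟨z, hz⟩ := exists_lorentz_of_forall_exp_mem
    (X := (c : Matrix (Fin 4) (Fin 4) ℝ) * lorentz y * ((c⁻¹ : GL (Fin 4) ℝ) :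
      Matrix (Fin 4) (Fin 4) ℝ)) (fun t => by
    rw [← Matrix.smul_mul, ← Matrix.mul_smul, hexp, ← map_smul]
    exact mul_mem (mul_mem hc (expGL_lorentz_mem_O _)) (inv_mem hc))
  exact ⟨z, hz, by rw [hz, hexp]⟩

/-- Conjugation by `c` carries the infinitesimal stabilizer of the time axis onto that of its image,
hence one generating set onto the other. -/
theorem closure_stabilizer_eq {c : GL (Fin 4) ℝ} (hc : c ∈ O 1 3) {𝔥 : Set (Fin 3 → ℂ)}
    (h : ∀ y, y ∈ 𝔥 ↔ lorentz y *ᵥ ((c : Matrix (Fin 4) (Fin 4) ℝ) *ᵥ timeAxis) = 0) :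
    Subgroup.closure ((fun y => expGL (lorentz y)) '' 𝔥) =
      SO3.map (MulAut.conj c).toMonoidHom := by
  rw [SO3_eq, le_antisymm timeAxisStabilizer_le rotationGroup_le, rotationGroup,
    MonoidHom.map_closure]
  congr 1
  ext g
  constructor
  · rintro ⟨y, hy, rfl⟩
    obtain ⟨z, hz, hz'⟩ := conj_lorentz (inv_mem hc) y
    refine ⟨expGL (lorentz z), ⟨z, ?_, rfl⟩, ?_⟩
    · rw [hz, inv_inv, ← Matrix.mulVec_mulVec, ← Matrix.mulVec_mulVec, (h y).mp hy,
        Matrix.mulVec_zero]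
    · change c * expGL (lorentz z) * c⁻¹ = expGL (lorentz y)
      rw [hz']
      group
  · rintro ⟨_, ⟨y, hy, rfl⟩, rfl⟩
    obtain ⟨z, hz, hz'⟩ := conj_lorentz hc y
    refine ⟨z, (h z).mpr ?_, hz'⟩
    rw [hz, ← Matrix.mulVec_mulVec, coe_mulVec_inv_mulVec, ← Matrix.mulVec_mulVec, hy,
      Matrix.mulVec_zero]

theorem IsConnectedLieSubgroup.exists_eq_closure {G : Subgroup (GL (Fin 4) ℝ)}
    (hG : IsConnectedLieSubgroup G) (hle : G ≤ O 1 3) :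
    ∃ 𝔥 : Submodule ℝ (Fin 3 → ℂ), (∀ c ∈ 𝔥, ∀ d ∈ 𝔥, c ⨯₃ d ∈ 𝔥) ∧
      G = Subgroup.closure ((fun c => expGL (lorentz c)) '' (𝔥 : Set (Fin 3 → ℂ))) := by
  obtain ⟨𝔤, h𝔤, hbr, hcl⟩ := hG
  have hmem : ∀ X ∈ 𝔤, ∃ c, lorentz c = X := by
    intro X hX
    refine exists_lorentz_of_forall_exp_mem fun t => hle ?_
    have hX' : X ∈ lieAlg G := h𝔤 ▸ hX
    obtain ⟨g, hg, hgX⟩ := hX' t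
    rwa [show expGL (t • X) = g from Units.ext hgX.symm]
  refine ⟨𝔤.comap lorentz, fun c hc d hd => ?_, ?_⟩
  · rw [Submodule.mem_comap, ← lorentz_bracket]
    exact hbr _ hc _ hd
  · rw [hcl]
    congr 1
    ext g
    constructor
    · rintro ⟨X, hX, hg⟩
      obtain ⟨c, rfl⟩ := hmem X hX
      exact ⟨c, hX, Units.ext hg.symm⟩
    · rintro ⟨c, hc, rfl⟩
      exact ⟨_, hc, rfl⟩

end EinsteinUniverse
end

/-! ### The trichotomy. -/

theorem theorem4p2p1 (G : Subgroup (GL (Fin 4) ℝ))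
    (hG : EinsteinUniverse.IsConnectedLieSubgroup G)
    (hle : G ≤ EinsteinUniverse.SO₀ 1 3)
    (hcoh : EinsteinUniverse.ActsWithCohomogeneityOne (G.map EinsteinUniverse.deSitterHom)) :
    (∃ p ∈ EinsteinUniverse.Ein, ∀ g ∈ G, EinsteinUniverse.deSitterHom g • p = p) ∨
    (∃ c ∈ EinsteinUniverse.SO₀ 1 3,
      G = EinsteinUniverse.SO3.map (MulAut.conj c).toMonoidHom) ∨
    G = EinsteinUniverse.SO₀ 1 3 := by
  open EinsteinUniverse in
  obtain ⟨𝔥, hbr, rfl⟩ := hG.exists_eq_closure (hle.trans SO₀_le_O)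
  by_cases hnd : ∀ n : Fin 3 → ℂ, (∀ c ∈ 𝔥, n ⬝ᵥ c = 0) → n = 0
  · have hspan : Submodule.span ℂ (𝔥 : Set (Fin 3 → ℂ)) = ⊤ := span_eq_top_of_forall_dotProduct hnd
    by_cases hreal : ∀ c ∈ 𝔥, Complex.I • c ∈ 𝔥 → c = 0
    · obtain ⟨x, hx, hker⟩ := exists_lorentz_kernel_vector hbr hnd hreal
      rcases le_or_gt 0 (mink x x) with hq | hq
      · exact Or.inl (exists_fixed_point_of_kernel hx hq hker)
      · obtain ⟨r, hr, hr0⟩ := exists_unit_timelike_multiple hq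
        obtain ⟨c, hc, hcx⟩ := exists_mem_SO₀_mulVec_timeAxis hr hr0
        have hker' : ∀ y ∈ 𝔥, lorentz y *ᵥ (r • x) = 0 := fun y hy => by
          rw [Matrix.mulVec_smul, hker y hy, smul_zero]
        refine Or.inr (Or.inl ⟨c, hc, closure_stabilizer_eq (SO₀_le_O hc) fun y => ?_⟩)
        rw [hcx]
        refine ⟨hker' y, fun hy => ?_⟩
        -- It remains to see that `𝔥` is the whole stabilizer. In `y = a + I b` both `b` and `I b`
        -- kill the timelike vector, so `b = 0`.
        obtain ⟨a, ha, b, hb, rfl⟩ := exists_eq_add_I_smul hspan y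
        rw [map_add, Matrix.add_mulVec, hker' a ha, zero_add] at hy
        have hb0 : b = 0 := lorentz_I_smul_eq_zero (by rw [hr]; norm_num) (hker' b hb) hy
        rw [hb0, smul_zero, add_zero]
        exact ha
    · push Not at hreal
      obtain ⟨w, hw, hIw, hw0⟩ := hreal
      have htop := eq_top_of_complex_line hbr hspan hw0 hw hIw
      refine Or.inr (Or.inr (le_antisymm hle (SO₀_le_of_forall_expGL_lorentz_mem fun c =>
        Subgroup.subset_closure ⟨c, ?_, rfl⟩)))
      rw [htop]
      trivial
  · push Not at hnd
    obtain ⟨n, hn, hn0⟩ := hnd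
    obtain ⟨m, hm, hmm, hm𝔥⟩ := exists_null_orthogonal hbr hn0 hn
    obtain ⟨x, hx, hq, hx𝔥⟩ := exists_null_eigenvector hm hmm
    exact Or.inl (exists_fixed_point_of_eigenvector hx hq fun c hc => hx𝔥 c (hm𝔥 c hc))
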